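/- Let $(\Omega,g)$ be a coordinate patch (signature $-+++$, oriented by its coordinates) on which $g$ is the Kerr metric with mass $\mathrm m>0$ and angular momentum parameter (per unit mass) $\mathrm a>0$: that is, $g=\Phi^*g_{\mathrm{Kerr}}$ on $\Omega$ for a smooth local diffeomorphism $\Phi$ of $\Omega$ into the set of points with $r^2+\mathrm a^2\cos^2\theta\neq0$, $r^2-2\mathrm m r+\mathrm a^2\neq 0$, $\sin\theta\neq0$ of the Boyer-Lindquist coordinate space $(t,r,\theta,\varphi)$, $r\in\mathbb R$. Let $W$ be the Weyl tensor of $g$, $\eta$ the metric volume element and $*$ the Hodge dual, and let $G_{abcd}=g_{ac}g_{bd}-g_{ad}g_{bc}$. On double 2-forms put $(P\circ Q)_{abcd}=\frac12P_{ab}{}^{mn}Q_{mncd}$, $\operatorname{Tr}P=\frac12P^{ab}{}_{ab}$, $P(Z)_{ab}=\frac12P_{ab}{}^{mn}Z_{mn}$; for 2-tensors put $(F\cdot H)_{ab}=F_{am}H^m{}_b$. Define $$A=\tfrac12\operatorname{Tr}W^2,\quad B=\tfrac12\operatorname{Tr}(W\circ *W),\quad D=\tfrac12\operatorname{Tr}W^3,\quad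 E=\tfrac12\operatorname{Tr}(W^2\circ *W),$$ $$\alpha=-\frac{AD+BE}{A^2+B^2},\qquad \beta=\frac{AE-BD}{A^2+B^2},\qquad w=\alpha+\mathrm i\beta .$$ For a smooth 2-form $Z$ on $\Omega$ put $F=(W-\alpha G-\beta\eta)(Z)$, $f=\operatorname{tr}F^2$, $\tilde f=\operatorname{tr}(F\cdot *F)$, $\chi=\sqrt{f^2+\tilde f^2}$, and define the canonical bivector, where $\chi\sqrt{\chi+f}\ne0$, by $$U=\frac{(\chi+f)F+\tilde f\,{*F}}{\chi\sqrt{\chi+f}} .$$ Let $h=g-U^2$, let $(\delta U)_b=-\nabla^aU_{ab}$ be the codifferential, and $$\lambda=\frac{(\delta U,\delta{*U})}{(\delta U)^2},\qquad \sigma=\frac{2\alpha}{3\lambda^2-1}-\frac14(\delta U)^2 .$$ Then at every point of $\Omega$ where $\chi\sqrt{\chi+f}\neq0$, $(\delta U)^2\ne0$ and $3\lambda^2\neq1$ one has $\sigma>0$, $$\mathrm m=\frac{|\alpha|}{\sigma\sqrt\sigma\,|3\lambda^2-1|},\qquad \mathrm a=\frac1{2\sigma\sqrt{1+\lambda^2}}\Big[h(\delta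 U,\delta U)+\frac{4\sigma\lambda^2}{1+\lambda^2}\Big]^{1/2},$$ and, with the real cube root, $$\xi=\Big(\frac{1-3\lambda^2}{\alpha}\Big)^{1/3}\frac1{\sqrt2}\,\delta U$$ is the stationary Killing vector: $\xi=w^{-1/3}\,\delta\mathcal U$ for a suitable value of the cube root, where $\mathcal U=\frac1{\sqrt2}(U-\mathrm i{*U})$; $\nabla_i\xi_j+\nabla_j\xi_i=0$; and in a neighbourhood of the point $\Phi_*\xi=\pm\sqrt2\,\mathrm m^{-1/3}\,\partial_t$ with a constant sign, which depends on the choice of sign of $U$. -/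

import Mathlib

open scoped Topology ContDiff

noncomputable section

namespace KerrWeyl

/-- A coordinate patch is an open subset of `ℝ⁴`. -/
abbrev Pt : Type := Fin 4 → ℝ

/-- Covariant 2-tensors at a point (components in the coordinate frame). -/
abbrev Tensor2 : Type := Matrix (Fin 4) (Fin 4) ℝ

/-- Covariant 4-tensors at a point, in particular double 2-forms. -/
abbrev Tensor4 : Type := Fin 4 → Fin 4 → Fin 4 → Fin 4 → ℝ

/-- Coordinate basis vector `∂ᵢ`. -/
def basisVec (i : Fin 4) : Pt := Pi.single i 1

/-- Partial derivative `∂ᵢ f` at `p`. -/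
def pderiv (i : Fin 4) (f : Pt → ℝ) (p : Pt) : ℝ := fderiv ℝ f p (basisVec i)

/-! ### Algebra at one point; `M` is the matrix of the metric, `M⁻¹` raises indices -/

section Algebra

variable (M : Tensor2)

/-- Metric product of two covectors. -/
def inner1 (u v : Pt) : ℝ := ∑ i, ∑ j, M⁻¹ i j * u i * v j

/-- The vector metrically equivalent to a covector. -/
def sharp (u : Pt) : Pt := fun i => ∑ j, M⁻¹ i j * u j

/-- `(A · B)_{ab} = A_{am} B^m_b`. -/
def dot2 (A B : Tensor2) : Tensor2 := A * M⁻¹ * B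

/-- `tr A = A^a_a`. -/
def tr2 (A : Tensor2) : ℝ := (M⁻¹ * A).trace

/-- Composition of double 2-forms, `½ P_{ab}^{mn} Q_{mncd}`. -/
def comp4 (P Q : Tensor4) : Tensor4 := fun a b c d =>
  (1 / 2) * ∑ m, ∑ n, ∑ k, ∑ l, P a b m n * M⁻¹ m k * M⁻¹ n l * Q k l c d

/-- Trace of a double 2-form, `½ P^{ab}_{ab}`. -/
def tr4 (P : Tensor4) : ℝ :=
  (1 / 2) * ∑ a, ∑ b, ∑ k, ∑ l, M⁻¹ a k * M⁻¹ b l * P k l a b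

/-- Action of a double 2-form on a bivector, `½ P_{ab}^{mn} X_{mn}`. -/
def act4 (P : Tensor4) (X : Tensor2) : Tensor2 := fun a b =>
  (1 / 2) * ∑ m, ∑ n, ∑ k, ∑ l, P a b m n * M⁻¹ m k * M⁻¹ n l * X k l

/-- The induced metric on 2-forms, `G = ½ g ∧ g`. -/
def metricG : Tensor4 := fun a b c d => M a c * M b d - M a d * M b c

/-- The Levi-Civita symbol, with `epsilon 0 1 2 3 = 1`. -/
def epsilon : Tensor4 := fun a b c d =>
  Matrix.det (Matrix.of ![basisVec a, basisVec b, basisVec c, basisVec d])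

/-- The metric volume element (the coordinates are positively oriented). -/
def volEl : Tensor4 := fun a b c d => Real.sqrt |M.det| * epsilon a b c d

/-- Hodge dual of a 2-form. -/
def hodge2 (F : Tensor2) : Tensor2 := act4 M (volEl M) F

/-- Hodge dual of a double 2-form. -/
def hodge4 (W : Tensor4) : Tensor4 := comp4 M (volEl M) W

/-- `A = ½ Tr W²`. -/
def invA (W : Tensor4) : ℝ := (1 / 2) * tr4 M (comp4 M W W)

/-- `B = ½ Tr (W ∘ *W)`. -/
def invB (W : Tensor4) : ℝ := (1 / 2) * tr4 M (comp4 M W (hodge4 M W))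

/-- `D = ½ Tr W³`. -/
def invD (W : Tensor4) : ℝ := (1 / 2) * tr4 M (comp4 M (comp4 M W W) W)

/-- `E = ½ Tr (W² ∘ *W)`. -/
def invE (W : Tensor4) : ℝ := (1 / 2) * tr4 M (comp4 M (comp4 M W W) (hodge4 M W))

/-- Real part `α = -(AD + BE)/(A² + B²)` of the double Weyl eigenvalue. -/
def eigRe (W : Tensor4) : ℝ :=
  -(invA M W * invD M W + invB M W * invE M W) / (invA M W ^ 2 + invB M W ^ 2)

/-- Imaginary part `β = (AE - BD)/(A² + B²)` of the double Weyl eigenvalue. -/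
def eigIm (W : Tensor4) : ℝ :=
  (invA M W * invE M W - invB M W * invD M W) / (invA M W ^ 2 + invB M W ^ 2)

/-- `P = W - α G - β η`. -/
def projP (W : Tensor4) : Tensor4 := fun a b c d =>
  W a b c d - eigRe M W * metricG M a b c d - eigIm M W * volEl M a b c d

/-- `F = P(Z)`. -/
def bivF (W : Tensor4) (Z : Tensor2) : Tensor2 := act4 M (projP M W) Z

/-- `f = tr F²`. -/
def scalF (W : Tensor4) (Z : Tensor2) : ℝ :=
  tr2 M (dot2 M (bivF M W Z) (bivF M W Z))

/-- `f̃ = tr (F · *F)`. -/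
def scalFt (W : Tensor4) (Z : Tensor2) : ℝ :=
  tr2 M (dot2 M (bivF M W Z) (hodge2 M (bivF M W Z)))

/-- `χ = √(f² + f̃²)`. -/
def scalChi (W : Tensor4) (Z : Tensor2) : ℝ :=
  Real.sqrt (scalF M W Z ^ 2 + scalFt M W Z ^ 2)

/-- The denominator `χ √(χ + f)` in the formula for the canonical bivector. -/
def denomU (W : Tensor4) (Z : Tensor2) : ℝ :=
  scalChi M W Z * Real.sqrt (scalChi M W Z + scalF M W Z)

/-- The canonical bivector `U = ((χ + f) F + f̃ *F) / (χ √(χ + f))`. -/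
def bivU (W : Tensor4) (Z : Tensor2) : Tensor2 :=
  (denomU M W Z)⁻¹ • ((scalChi M W Z + scalF M W Z) • bivF M W Z
    + scalFt M W Z • hodge2 M (bivF M W Z))

/-- The projector `h = g - U²` on the space-like principal plane. -/
def projH (U : Tensor2) : Tensor2 := M - dot2 M U U

end Algebra

/-! ### Differential geometry of a metric field `g` -/

section Geometry

variable (g : Pt → Tensor2)

/-- Christoffel symbols `Γ^k_{ij}` of the Levi-Civita connection. -/
def christoffel (k i j : Fin 4) (p : Pt) : ℝ :=
  (1 / 2) * ∑ l, (g p)⁻¹ k l *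
    (pderiv i (fun q => g q l j) p + pderiv j (fun q => g q l i) p
      - pderiv l (fun q => g q i j) p)

/-- Riemann tensor `R^a_{bcd} = ∂_c Γ^a_{bd} - ∂_d Γ^a_{bc} + Γ^e_{bd} Γ^a_{ec} - Γ^e_{bc} Γ^a_{ed}`. -/
def riemannUp (a b c d : Fin 4) (p : Pt) : ℝ :=
  pderiv c (christoffel g a b d) p - pderiv d (christoffel g a b c) p
    + ∑ e, (christoffel g e b d p * christoffel g a e c p
      - christoffel g e b c p * christoffel g a e d p)

/-- Riemann tensor with all indices down. -/
def riemann (p : Pt) : Tensor4 := fun a b c d => ∑ e, g p a e * riemannUp g e b c d p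

/-- Ricci tensor `R_{bd} = R^a_{bad}`. -/
def ricci (p : Pt) : Tensor2 := fun b d => ∑ a, riemannUp g a b a d p

/-- Scalar curvature. -/
def scalarCurv (p : Pt) : ℝ := tr2 (g p) (ricci g p)

/-- Weyl tensor in dimension four. -/
def weyl (p : Pt) : Tensor4 := fun a b c d =>
  riemann g p a b c d
    - (1 / 2) * (g p a c * ricci g p b d + g p b d * ricci g p a c
        - g p a d * ricci g p b c - g p b c * ricci g p a d)
    + (scalarCurv g p / 6) * (g p a c * g p b d - g p a d * g p b c)

/-- Covariant derivative of a 1-form, `∇_i u_j`. -/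
def covDeriv1 (u : Pt → Pt) (i j : Fin 4) (p : Pt) : ℝ :=
  pderiv i (fun q => u q j) p - ∑ e, christoffel g e i j p * u p e

/-- Covariant derivative of a 2-form, `∇_c F_{ab}`. -/
def covDeriv2 (F : Pt → Tensor2) (c a b : Fin 4) (p : Pt) : ℝ :=
  pderiv c (fun q => F q a b) p
    - ∑ e, (christoffel g e c a p * F p e b + christoffel g e c b p * F p a e)

/-- Exterior codifferential of a 2-form, `(δF)_b = -∇^a F_{ab}`. -/
def codiff (F : Pt → Tensor2) (p : Pt) : Pt := fun b =>
  -∑ a, ∑ c, (g p)⁻¹ a c * covDeriv2 g F c a b p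

/-- `α` as a scalar field. -/
def alpha (p : Pt) : ℝ := eigRe (g p) (weyl g p)

/-- `β` as a scalar field. -/
def beta (p : Pt) : ℝ := eigIm (g p) (weyl g p)

variable (Z : Pt → Tensor2)

/-- The formula for the canonical bivector makes sense at `p` for the auxiliary bivector `Z`. -/
def Admissible (p : Pt) : Prop := denomU (g p) (weyl g p) (Z p) ≠ 0

/-- The canonical bivector field `U`. -/
def canU (p : Pt) : Tensor2 := bivU (g p) (weyl g p) (Z p)

/-- The 1-form `δU`. -/
def deltaU (p : Pt) : Pt := codiff g (canU g Z) p

/-- The 1-form `δ*U`. -/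
def deltaStarU (p : Pt) : Pt := codiff g (fun q => hodge2 (g q) (canU g Z q)) p

/-- `(δU)²`. -/
def deltaUSq (p : Pt) : ℝ := inner1 (g p) (deltaU g Z p) (deltaU g Z p)

/-- `λ = (δU, δ*U)/(δU)²`. -/
def lam (p : Pt) : ℝ := inner1 (g p) (deltaU g Z p) (deltaStarU g Z p) / deltaUSq g Z p

/-- `σ = 2α/(3λ² - 1) - (δU)²/4`. -/
def sigma (p : Pt) : ℝ :=
  2 * alpha g p / (3 * lam g Z p ^ 2 - 1) - (1 / 4) * deltaUSq g Z p

/-- `h(δU, δU)`. -/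
def hDelta (p : Pt) : ℝ :=
  ∑ a, ∑ b, projH (g p) (canU g Z p) a b
    * sharp (g p) (deltaU g Z p) a * sharp (g p) (deltaU g Z p) b

/-- The real cube root, also of negative numbers. -/
def cbrt (x : ℝ) : ℝ := Real.sign x * |x| ^ (1 / 3 : ℝ)

/-- The 1-form `((1 - 3λ²)/α)^{1/3} δU / √2`. -/
def xiForm (p : Pt) : Pt :=
  (cbrt ((1 - 3 * lam g Z p ^ 2) / alpha g p) / Real.sqrt 2) • deltaU g Z p

/-- The vector field metrically equivalent to `xiForm`. -/
def xiVec (p : Pt) : Pt := sharp (g p) (xiForm g Z p)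

end Geometry

/-! ### The Kerr metric -/

/-- `Σ = r² + a² cos² θ` in Boyer-Lindquist coordinates `(t, r, θ, φ)`. -/
def kerrSigma (a : ℝ) (x : Pt) : ℝ := x 1 ^ 2 + a ^ 2 * Real.cos (x 2) ^ 2

/-- `Δ = r² - 2 m r + a²`. -/
def kerrDelta (m a : ℝ) (x : Pt) : ℝ := x 1 ^ 2 - 2 * m * x 1 + a ^ 2

/-- The Kerr metric with mass `m` and angular momentum (per unit mass) `a` in Boyer-Lindquist
coordinates `(t, r, θ, φ)`. -/
def kerrMetric (m a : ℝ) (x : Pt) : Tensor2 :=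
  !![-(1 - 2 * m * x 1 / kerrSigma a x), 0, 0,
        -(2 * m * x 1 * a * Real.sin (x 2) ^ 2 / kerrSigma a x);
     0, kerrSigma a x / kerrDelta m a x, 0, 0;
     0, 0, kerrSigma a x, 0;
     -(2 * m * x 1 * a * Real.sin (x 2) ^ 2 / kerrSigma a x), 0, 0,
        (x 1 ^ 2 + a ^ 2 + 2 * m * x 1 * a ^ 2 * Real.sin (x 2) ^ 2 / kerrSigma a x)
          * Real.sin (x 2) ^ 2]

/-- The points where the Boyer-Lindquist form is regular: off the ring singularity, the horizons
and the axis. All the regions separated by the horizons, and `r < 0`, are included. -/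
def kerrDomain (m a : ℝ) : Set Pt :=
  {x | kerrSigma a x ≠ 0 ∧ kerrDelta m a x ≠ 0 ∧ Real.sin (x 2) ≠ 0}

/-- Jacobian matrix `∂_j Φ^i`. -/
def jacobian (Φ : Pt → Pt) (p : Pt) : Tensor2 := fun i j => pderiv j (fun q => Φ q i) p

/-- The metric `g` on the coordinate patch `Ω` is the Kerr metric with parameters `m` and `a`,
written in arbitrary coordinates: `Φ`, of either orientation, is a smooth local isometry. -/
structure IsKerrOn (m a : ℝ) (g : Pt → Tensor2) (Ω : Set Pt) (Φ : Pt → Pt) : Prop where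
  isOpen : IsOpen Ω
  smooth : ContDiffOn ℝ ∞ Φ Ω
  mapsTo : Set.MapsTo Φ Ω (kerrDomain m a)
  det_ne_zero : ∀ p ∈ Ω, (jacobian Φ p).det ≠ 0
  pullback : ∀ p ∈ Ω,
    g p = (jacobian Φ p).transpose * kerrMetric m a (Φ p) * jacobian Φ p

end KerrWeyl

end

/-!
The Kerr metric is written in a null coframe whose components are rational in `r`, `sin θ`, `cos θ`
and the two functions `u = r / Σ`, `v = a cos θ / Σ` (`kerrU`, `kerrV`), for which
`u - i v = 1 / (r + i a cos θ)`.  The coframe is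
`e⁰ = dt - (Σ/Δ) dr - a sin²θ dφ`, `e¹ = (Δ/2Σ) (dt - a sin²θ dφ) + dr/2`,
`e² + i e³ = (r + i a cos θ) dθ + i (u + i v) sin θ (a dt - (r² + a²) dφ)`, and
`g = -2 e⁰ e¹ + e²e² + e³e³`.  Being null, it needs no square root of `Δ`, so it works on both sides
of the horizons.

*Curvature.*  Connection forms `ω` are given explicitly (`kerrConn`), and the structure equations
`de + ω ∧ e = 0` and `dω + ω ∧ ω = R` are polynomial identities in the atoms above
(`kerr_torsion`, `kerr_curvature`).  Both equations pull back along `Φ`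
(`pull_torsion`, `pull_curvature`), and a coframe with skew torsion-free connection forms computes
the Christoffel symbols, the Riemann tensor and covariant derivatives of tensors with constant frame
components (`MovingFrame`).  So everything about `g` on the patch reduces to algebra in the frame,
apart from a sign `orient`, since `Φ` may reverse the orientation.

*Algebra.*  Let `U = e⁰ ∧ e¹` and `V = *U`.  The double two-forms
`a G + b η + c (U⊗U - V⊗V) + d (U⊗V + V⊗U)` (`typeD`) are closed under composition and the Hodge
dual; with `* = i` they form the commutative algebra `ℂ[P] / (P² = -P)`.  The Kerr curvature is
`w (1 + 3 P)` with `w = -m (u - i v)³ = -m / (r + i a cos θ)³`, up to conjugation of `w` by the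
orientation; it is Ricci flat, hence equals the Weyl tensor.  Traces in this algebra show
that the rational expressions in the invariants `A, B, D, E` return `w` (`IsDualPair.eig_typeD`).
Consequently `W - αG - βη = 3 w P` maps every bivector into the span of `U` and `V`, and the
normalisation in the definition of the canonical bivector turns the result into `±U`, with a locally
constant sign (`IsDualPair.bivU_typeD`, `IsKerrOn.canU_eventually`).

*Codifferentials.*  With `τ` the one-form of `∂_t`, a frame computation gives
`δ(e⁰ ∧ e¹) = -2 u τ` and `δ(*(e⁰ ∧ e¹)) = ∓2 v τ` (`kerr_codiff`), together with
`τ² = (2 m r - Σ) / Σ` and `h(τ, τ) = a² sin²θ / Σ`.  Hence `λ = ±a cos θ / r`, `σ = u²`, the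
quotient `(1 - 3λ²) / α` is the cube of `-Σ / (m^{1/3} r)`, and `ξ = ±√2 m^{-1/3} τ`; the formulas
for `m` and `a` follow by substitution, and the Killing equation for `τ` is checked in the frame
(`kerr_killing`).
-/

noncomputable section

namespace KerrWeyl

/-! ### Partial derivatives of functions and of matrix-valued functions -/
theorem pderiv_const (i : Fin 4) (k : ℝ) (p : Pt) : pderiv i (fun _ => k) p = 0 := by
  simp [pderiv]

theorem pderiv_add {i : Fin 4} {f h : Pt → ℝ} {p : Pt} (hf : DifferentiableAt ℝ f p)
    (hh : DifferentiableAt ℝ h p) :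
    pderiv i (fun q => f q + h q) p = pderiv i f p + pderiv i h p := by
  simp [pderiv, fderiv_fun_add hf hh]

theorem pderiv_sub {i : Fin 4} {f h : Pt → ℝ} {p : Pt} (hf : DifferentiableAt ℝ f p)
    (hh : DifferentiableAt ℝ h p) :
    pderiv i (fun q => f q - h q) p = pderiv i f p - pderiv i h p := by
  simp [pderiv, fderiv_fun_sub hf hh]

theorem pderiv_neg {i : Fin 4} {f : Pt → ℝ} {p : Pt} :
    pderiv i (fun q => -f q) p = -pderiv i f p := by
  simp [pderiv, fderiv_fun_neg]

theorem pderiv_mul {i : Fin 4} {f h : Pt → ℝ} {p : Pt} (hf : DifferentiableAt ℝ f p)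
    (hh : DifferentiableAt ℝ h p) :
    pderiv i (fun q => f q * h q) p = pderiv i f p * h p + f p * pderiv i h p := by
  simp [pderiv, fderiv_fun_mul hf hh]; ring

theorem pderiv_pow {i : Fin 4} {f : Pt → ℝ} {p : Pt} (n : ℕ) (hf : DifferentiableAt ℝ f p) :
    pderiv i (fun q => f q ^ n) p = n * f p ^ (n - 1) * pderiv i f p := by
  simp [pderiv, fderiv_fun_pow n hf]

theorem pderiv_inv {i : Fin 4} {f : Pt → ℝ} {p : Pt} (hf : DifferentiableAt ℝ f p)
    (h0 : f p ≠ 0) :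
    pderiv i (fun q => (f q)⁻¹) p = -pderiv i f p * (f p)⁻¹ ^ 2 := by
  have := (hasDerivAt_inv h0).comp_hasFDerivAt p hf.hasFDerivAt
  have h2 := this.fderiv
  simp only [Function.comp_def] at h2
  simp [pderiv, h2, mul_comm]

theorem pderiv_coord (i j : Fin 4) (p : Pt) :
    pderiv i (fun q : Pt => q j) p = if i = j then 1 else 0 := by
  have : HasFDerivAt (fun q : Pt => q j) (ContinuousLinearMap.proj j : Pt →L[ℝ] ℝ) p :=
    (ContinuousLinearMap.proj j : Pt →L[ℝ] ℝ).hasFDerivAt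
  simp [pderiv, this.fderiv, basisVec, Pi.single_apply, eq_comm]

theorem pderiv_sin (i : Fin 4) (p : Pt) :
    pderiv i (fun q => Real.sin (q 2)) p = if i = 2 then Real.cos (p 2) else 0 := by
  have h := pderiv_coord i 2 p
  have : DifferentiableAt ℝ (fun q : Pt => q 2) p := by fun_prop
  have h2 := (this.hasFDerivAt.sin).fderiv
  simp only [pderiv] at h ⊢
  rw [h2]; simp [h]

theorem pderiv_cos (i : Fin 4) (p : Pt) :
    pderiv i (fun q => Real.cos (q 2)) p = if i = 2 then -Real.sin (p 2) else 0 := by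
  have h := pderiv_coord i 2 p
  have : DifferentiableAt ℝ (fun q : Pt => q 2) p := by fun_prop
  have h2 := (this.hasFDerivAt.cos).fderiv
  simp only [pderiv] at h ⊢
  rw [h2]; simp [h]

/-- Entrywise partial derivative of a matrix-valued function. -/
def mpderiv (i : Fin 4) (A : Pt → Tensor2) (p : Pt) : Tensor2 :=
  Matrix.of fun a b => pderiv i (fun q => A q a b) p

/-- Entrywise differentiability of a matrix-valued function. -/
def MDiffAt (A : Pt → Tensor2) (p : Pt) : Prop :=
  ∀ a b, DifferentiableAt ℝ (fun q => A q a b) p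

theorem pderiv_congr {i : Fin 4} {f h : Pt → ℝ} {p : Pt} (hfh : f =ᶠ[𝓝 p] h) :
    pderiv i f p = pderiv i h p := by
  simp only [pderiv, hfh.fderiv_eq]

theorem pderiv_sum {ι : Type*} {s : Finset ι} {i : Fin 4} {f : ι → Pt → ℝ} {p : Pt}
    (hf : ∀ k ∈ s, DifferentiableAt ℝ (f k) p) :
    pderiv i (fun q => ∑ k ∈ s, f k q) p = ∑ k ∈ s, pderiv i (f k) p := by
  simp [pderiv, fderiv_fun_sum hf]

theorem mpderiv_congr {i : Fin 4} {A B : Pt → Tensor2} {p : Pt} (h : A =ᶠ[𝓝 p] B) :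
    mpderiv i A p = mpderiv i B p := by
  ext a b
  exact pderiv_congr (h.mono fun q hq => congrArg (fun M : Tensor2 => M a b) hq)

theorem mpderiv_const (i : Fin 4) (A : Tensor2) (p : Pt) : mpderiv i (fun _ => A) p = 0 := by
  ext a b
  exact pderiv_const i _ p

theorem mpderiv_transpose (i : Fin 4) (A : Pt → Tensor2) (p : Pt) :
    mpderiv i (fun q => (A q).transpose) p = (mpderiv i A p).transpose := rfl

theorem MDiffAt.const (A : Tensor2) (p : Pt) : MDiffAt (fun _ => A) p :=
  fun _ _ => differentiableAt_const _

theorem MDiffAt.transpose {A : Pt → Tensor2} {p : Pt} (hA : MDiffAt A p) :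
    MDiffAt (fun q => (A q).transpose) p := fun a b => hA b a

theorem MDiffAt.add {A B : Pt → Tensor2} {p : Pt} (hA : MDiffAt A p) (hB : MDiffAt B p) :
    MDiffAt (fun q => A q + B q) p := fun a b => (hA a b).add (hB a b)

theorem MDiffAt.mul {A B : Pt → Tensor2} {p : Pt} (hA : MDiffAt A p) (hB : MDiffAt B p) :
    MDiffAt (fun q => A q * B q) p := fun a b => by
  simp only [Matrix.mul_apply]
  exact DifferentiableAt.fun_sum fun k _ => (hA a k).mul (hB k b)

theorem MDiffAt.congr {A B : Pt → Tensor2} {p : Pt} (hA : MDiffAt A p) (h : B =ᶠ[𝓝 p] A) :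
    MDiffAt B p := fun a b =>
  (hA a b).congr_of_eventuallyEq (h.mono fun _ hq => congrArg (fun M : Tensor2 => M a b) hq)

theorem mpderiv_add {i : Fin 4} {A B : Pt → Tensor2} {p : Pt} (hA : MDiffAt A p)
    (hB : MDiffAt B p) :
    mpderiv i (fun q => A q + B q) p = mpderiv i A p + mpderiv i B p := by
  ext a b
  exact pderiv_add (hA a b) (hB a b)

theorem mpderiv_mul {i : Fin 4} {A B : Pt → Tensor2} {p : Pt} (hA : MDiffAt A p)
    (hB : MDiffAt B p) :
    mpderiv i (fun q => A q * B q) p = mpderiv i A p * B p + A p * mpderiv i B p := by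
  ext a b
  simp only [mpderiv, Matrix.mul_apply, Matrix.of_apply, Matrix.add_apply]
  rw [← Finset.sum_add_distrib]
  refine (pderiv_sum fun k _ => (hA a k).fun_mul (hB k b)).trans ?_
  exact Finset.sum_congr rfl fun k _ => pderiv_mul (hA a k) (hB k b)

theorem MDiffAt.det {A : Pt → Tensor2} {p : Pt} (hA : MDiffAt A p) :
    DifferentiableAt ℝ (fun q => (A q).det) p := by
  simp only [Matrix.det_apply', Fin.prod_univ_four]
  exact DifferentiableAt.fun_sum fun σ _ =>
    ((((hA _ _).fun_mul (hA _ _)).fun_mul (hA _ _)).fun_mul (hA _ _)).const_mul _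

theorem MDiffAt.inv {A : Pt → Tensor2} {p : Pt} (hA : MDiffAt A p) (h : (A p).det ≠ 0) :
    MDiffAt (fun q => (A q)⁻¹) p := by
  intro a b
  simp only [Matrix.inv_def, Matrix.smul_apply, smul_eq_mul, Ring.inverse_eq_inv',
    Matrix.adjugate_apply]
  refine (hA.det.inv h).mul (MDiffAt.det (A := fun q => (A q).updateRow b (Pi.single a 1)) ?_)
  intro k l
  by_cases hk : k = b
  · subst hk; simp
  · simpa [Matrix.updateRow_ne hk] using hA k l

theorem differentiableAt_pderiv {f : Pt → ℝ} {p : Pt} (hf : ContDiffAt ℝ 2 f p) (i : Fin 4) :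
    DifferentiableAt ℝ (pderiv i f) p := by
  have h := (hf.fderiv_right (m := 1) (by norm_num)).differentiableAt (by norm_num)
  exact h.clm_apply (differentiableAt_const _)

theorem pderiv_comm {f : Pt → ℝ} {p : Pt} (hf : ContDiffAt ℝ 2 f p) (i j : Fin 4) :
    pderiv i (pderiv j f) p = pderiv j (pderiv i f) p := by
  have h := (hf.fderiv_right (m := 1) (by norm_num)).differentiableAt (by norm_num)
  have key : ∀ k l : Fin 4, pderiv k (pderiv l f) p
      = fderiv ℝ (fderiv ℝ f) p (basisVec k) (basisVec l) := by
    intro k l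
    have h1 := (h.hasFDerivAt.clm_apply (hasFDerivAt_const (basisVec l) p)).fderiv
    have h2 : pderiv l f = fun y => fderiv ℝ f y (basisVec l) := rfl
    rw [h2, pderiv, h1]; simp
  rw [key, key]
  exact (hf.isSymmSndFDerivAt (by simp)) _ _

theorem pderiv_comp {A : Pt → ℝ} {Φ : Pt → Pt} {p : Pt} (hA : DifferentiableAt ℝ A (Φ p))
    (hΦ : DifferentiableAt ℝ Φ p) (j : Fin 4) :
    pderiv j (fun q => A (Φ q)) p = ∑ k, pderiv k A (Φ p) * jacobian Φ p k j := by
  have h1 := (hA.hasFDerivAt.comp p hΦ.hasFDerivAt).fderiv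
  have h2 : ∀ k, jacobian Φ p k j = fderiv ℝ Φ p (basisVec j) k := fun k => by
    have := (hasFDerivAt_pi'.1 hΦ.hasFDerivAt k).fderiv
    simp only [jacobian, pderiv]
    rw [this]; rfl
  have h3 : fderiv ℝ Φ p (basisVec j) = ∑ k, jacobian Φ p k j • basisVec k := by
    ext l
    simp [h2, basisVec, Pi.single_apply]
  change fderiv ℝ (A ∘ Φ) p (basisVec j) = _
  rw [h1, ContinuousLinearMap.comp_apply, h3, map_sum]
  refine Finset.sum_congr rfl fun k _ => ?_
  rw [map_smul, smul_eq_mul, mul_comm]; rfl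

/-! ### Moving frames and their connection forms -/

/-- A coframe `e` of `g` on `Ω` with constant frame metric `N`, together with its Levi-Civita
connection forms. The row `e q α` lists the coordinate components of the one-form `e^α`, so that
`g = eᵀ N e`; `ϖ i` is the matrix `ϖ^α_β(∂_i)`, `torsion` is `de + ϖ ∧ e = 0`, and `skew` says that
`ϖ` takes values in the Lie algebra of `N`. -/
structure MovingFrame (N : Tensor2) (g : Pt → Tensor2) (Ω : Set Pt) (e : Pt → Tensor2)
    (ϖ : Fin 4 → Pt → Tensor2) : Prop where
  isOpen : IsOpen Ω
  symm : N.transpose = N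
  det_metric : N.det ≠ 0
  metric : ∀ q ∈ Ω, g q = (e q).transpose * N * e q
  det_ne : ∀ q ∈ Ω, (e q).det ≠ 0
  smooth : ∀ q ∈ Ω, ∀ α i, ContDiffAt ℝ 2 (fun x => e x α i) q
  smooth_conn : ∀ q ∈ Ω, ∀ i, MDiffAt (ϖ i) q
  torsion : ∀ q ∈ Ω, ∀ α i j, (mpderiv i e q + ϖ i q * e q) α j = (mpderiv j e q + ϖ j q * e q) α i
  skew : ∀ q ∈ Ω, ∀ i, (ϖ i q).transpose * N + N * ϖ i q = 0

/-- The matrix `Γ^k_{ij}` with row `k` and column `j`, for a fixed direction `i`. -/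
def christoffelMat (g : Pt → Tensor2) (i : Fin 4) (p : Pt) : Tensor2 :=
  Matrix.of fun k j => christoffel g k i j p

/-- The inverse metric has frame components `N⁻¹`. -/
theorem conj_inv {e : Tensor2} (N : Tensor2) (he : e.det ≠ 0) :
    e * (e.transpose * N * e)⁻¹ * e.transpose = N⁻¹ := by
  have he' : IsUnit e.det := he.isUnit
  have het : IsUnit e.transpose.det := by rwa [Matrix.det_transpose]
  rw [Matrix.mul_inv_rev, Matrix.mul_inv_rev]
  simp only [← Matrix.mul_assoc, Matrix.mul_nonsing_inv _ he', Matrix.one_mul]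
  rw [Matrix.mul_assoc, Matrix.nonsing_inv_mul _ het, Matrix.mul_one]

namespace MovingFrame

variable {N : Tensor2} {g : Pt → Tensor2} {Ω : Set Pt} {e : Pt → Tensor2}
    {ϖ : Fin 4 → Pt → Tensor2} (h : MovingFrame N g Ω e ϖ) {p : Pt} (hp : p ∈ Ω)
include h hp

theorem eventually_mem : ∀ᶠ q in 𝓝 p, q ∈ Ω := h.isOpen.mem_nhds hp

theorem mdiff : MDiffAt e p := fun α i => (h.smooth p hp α i).differentiableAt (by norm_num)

theorem metric_inv : e p * (g p)⁻¹ * (e p).transpose = N⁻¹ := by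
  rw [h.metric p hp]
  exact conj_inv N (h.det_ne p hp)

/-- `∂_i g_{lj}` is the symmetrisation of `(eᵀ N (∂_i e + ϖ_i e))_{lj}`: skewness of `ϖ` lets the
connection term be added for free. -/
theorem pderiv_metric (i l j : Fin 4) :
    pderiv i (fun q => g q l j) p
      = ((e p).transpose * N * (mpderiv i e p + ϖ i p * e p)) l j
        + ((e p).transpose * N * (mpderiv i e p + ϖ i p * e p)) j l := by
  have h1 : mpderiv i g p = (e p).transpose * N * (mpderiv i e p + ϖ i p * e p)
      + ((e p).transpose * N * (mpderiv i e p + ϖ i p * e p)).transpose := by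
    rw [mpderiv_congr ((h.eventually_mem hp).mono fun q hq => h.metric q hq),
      mpderiv_mul ((h.mdiff hp).transpose.mul (MDiffAt.const N p)) (h.mdiff hp),
      mpderiv_mul (h.mdiff hp).transpose (MDiffAt.const N p), mpderiv_const, mpderiv_transpose]
    simp only [Matrix.transpose_mul, Matrix.transpose_add, Matrix.transpose_transpose, h.symm,
      Matrix.mul_add, Matrix.mul_zero, add_zero]
    have h2 := congrArg (fun X => (e p).transpose * X * e p) (h.skew p hp i)
    simp only [Matrix.mul_add, Matrix.add_mul, Matrix.mul_zero, Matrix.zero_mul] at h2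
    rw [← sub_eq_zero]
    rw [← neg_eq_zero, ← h2]
    simp only [Matrix.mul_assoc]
    abel
  exact congrFun (congrFun h1 l) j

/-- The Levi-Civita connection in the frame, `e Γ_i = ∂_i e + ϖ_i e`. By `torsion` the lowered
matrix `eᵀ N (∂_i e + ϖ_i e)` is symmetric in `i` and `j`, so the Koszul combination returns it. -/
theorem christoffel_eq (i : Fin 4) :
    e p * christoffelMat g i p = mpderiv i e p + ϖ i p * e p := by
  have h1 : christoffelMat g i p
      = (g p)⁻¹ * ((e p).transpose * N * (mpderiv i e p + ϖ i p * e p)) := by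
    ext k j
    have hsw : ∀ i j l, ((e p).transpose * N * (mpderiv i e p + ϖ i p * e p)) l j
        = ((e p).transpose * N * (mpderiv j e p + ϖ j p * e p)) l i := by
      intro i j l
      rw [Matrix.mul_apply, Matrix.mul_apply]
      exact Finset.sum_congr rfl fun α _ => by rw [h.torsion p hp α i j]
    simp only [christoffelMat, Matrix.of_apply, christoffel]
    rw [Matrix.mul_apply, Finset.mul_sum]
    refine Finset.sum_congr rfl fun l _ => ?_
    rw [h.pderiv_metric hp, h.pderiv_metric hp, h.pderiv_metric hp, hsw j i l, hsw i l j, hsw j l i]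
    ring
  have hN : IsUnit N.det := h.det_metric.isUnit
  calc e p * christoffelMat g i p
      = (e p * (g p)⁻¹ * (e p).transpose) * N * (mpderiv i e p + ϖ i p * e p) := by
        rw [h1]; simp only [Matrix.mul_assoc]
    _ = _ := by rw [h.metric_inv hp, Matrix.nonsing_inv_mul _ hN, Matrix.one_mul]

theorem christoffel_symm (k i j : Fin 4) : christoffel g k i j p = christoffel g k j i p := by
  have hg : ∀ a b, (fun q => g q a b) =ᶠ[𝓝 p] fun q => g q b a := fun a b =>
    (h.eventually_mem hp).mono fun q hq => by
      have : (g q).transpose = g q := by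
        rw [h.metric q hq]
        simp only [Matrix.transpose_mul, Matrix.transpose_transpose, h.symm, Matrix.mul_assoc]
      exact congrFun (congrFun this b) a
  simp only [christoffel]
  congr 1
  refine Finset.sum_congr rfl fun l _ => ?_
  rw [pderiv_congr (hg i j)]
  ring

theorem mdiff_deriv (i : Fin 4) : MDiffAt (mpderiv i e) p :=
  fun α j => differentiableAt_pderiv (h.smooth p hp α j) i

theorem mdiff_christoffelMat (i : Fin 4) : MDiffAt (christoffelMat g i) p := by
  refine (((h.mdiff hp).inv (h.det_ne p hp)).mul ((h.mdiff_deriv hp i).add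
    ((h.smooth_conn p hp i).mul (h.mdiff hp)))).congr ?_
  refine (h.eventually_mem hp).mono fun q hq => ?_
  simp only
  rw [← h.christoffel_eq hq, ← Matrix.mul_assoc,
    Matrix.nonsing_inv_mul _ (h.det_ne q hq).isUnit, Matrix.one_mul]

/-- Cartan's second structure equation `e R(∂_c, ∂_d) = (dϖ + ϖ ∧ ϖ)(∂_c, ∂_d) e`: differentiate
`e Γ_d = ∂_d e + ϖ_d e` along `∂_c` and antisymmetrise. -/
theorem riemannUp_eq (c d : Fin 4) :
    e p * (Matrix.of fun a b => riemannUp g a b c d p)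
      = (mpderiv c (ϖ d) p - mpderiv d (ϖ c) p + (ϖ c p * ϖ d p - ϖ d p * ϖ c p)) * e p := by
  have h1 : (Matrix.of fun a b => riemannUp g a b c d p) =
      mpderiv c (christoffelMat g d) p - mpderiv d (christoffelMat g c) p
        + (christoffelMat g c p * christoffelMat g d p
          - christoffelMat g d p * christoffelMat g c p) := by
    ext a b
    simp only [riemannUp, Matrix.of_apply, mpderiv, christoffelMat, Matrix.add_apply,
      Matrix.sub_apply, Matrix.mul_apply, ← Finset.sum_sub_distrib]
    congr 1
    · congr 1 <;> refine pderiv_congr ((h.eventually_mem hp).mono fun q hq => ?_)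
      · exact h.christoffel_symm hq _ _ _
      · exact h.christoffel_symm hq _ _ _
    · refine Finset.sum_congr rfl fun k _ => ?_
      rw [h.christoffel_symm hp k b d, h.christoffel_symm hp a k c, h.christoffel_symm hp k b c,
        h.christoffel_symm hp a k d]
      ring
  have h2 : ∀ c d, mpderiv c e p * christoffelMat g d p + e p * mpderiv c (christoffelMat g d) p
      = mpderiv c (mpderiv d e) p + (mpderiv c (ϖ d) p * e p + ϖ d p * mpderiv c e p) := by
    intro c d
    rw [← mpderiv_mul (h.mdiff hp) (h.mdiff_christoffelMat hp d),
      ← mpderiv_mul (h.smooth_conn p hp d) (h.mdiff hp),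
      ← mpderiv_add (h.mdiff_deriv hp d) ((h.smooth_conn p hp d).mul (h.mdiff hp))]
    exact mpderiv_congr ((h.eventually_mem hp).mono fun q hq => h.christoffel_eq hq d)
  have h3 : mpderiv c (mpderiv d e) p = mpderiv d (mpderiv c e) p := by
    ext α j
    exact pderiv_comm (h.smooth p hp α j) c d
  have h4 : ∀ c, mpderiv c e p = e p * christoffelMat g c p - ϖ c p * e p := fun c => by
    rw [h.christoffel_eq hp]; abel
  have h5 := h2 c d
  have h6 := h2 d c
  rw [h3] at h5
  rw [h4 c] at h5
  rw [h4 d] at h6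
  rw [h1]
  simp only [Matrix.mul_add, Matrix.mul_sub, Matrix.add_mul, Matrix.sub_mul, Matrix.mul_assoc] at *
  rw [← sub_eq_zero] at h5 h6 ⊢
  have h8 := congrArg₂ (· - ·) h5 h6
  simp only [sub_zero] at h8
  rw [← h8]
  abel

/-- Covariant derivative of a two-tensor with constant frame components. -/
theorem covDeriv2_eq {F : Pt → Tensor2} {F₀ : Tensor2}
    (hF : ∀ᶠ q in 𝓝 p, F q = (e q).transpose * F₀ * e q) (c a b : Fin 4) :
    covDeriv2 g F c a b p
      = -((e p).transpose * ((ϖ c p).transpose * F₀ + F₀ * ϖ c p) * e p) a b := by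
  have h1 : (Matrix.of fun a b => covDeriv2 g F c a b p : Tensor2) = mpderiv c F p
      - (christoffelMat g c p).transpose * F p - F p * christoffelMat g c p := by
    ext a b
    simp only [covDeriv2, Matrix.of_apply, mpderiv, christoffelMat, Matrix.sub_apply,
      Matrix.mul_apply, Matrix.transpose_apply, Finset.sum_add_distrib]
    simp only [mul_comm (F p a _)]
    ring
  have h2 : mpderiv c F p = (mpderiv c e p).transpose * F₀ * e p
      + (e p).transpose * F₀ * mpderiv c e p := by
    rw [mpderiv_congr hF, 
      mpderiv_mul ((h.mdiff hp).transpose.mul (MDiffAt.const F₀ p)) (h.mdiff hp),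
      mpderiv_mul (h.mdiff hp).transpose (MDiffAt.const F₀ p), mpderiv_const, mpderiv_transpose,
      Matrix.mul_zero, add_zero]
  have h3 : mpderiv c e p = e p * christoffelMat g c p - ϖ c p * e p := by
    rw [h.christoffel_eq hp]; abel
  have h4 : (Matrix.of fun a b => covDeriv2 g F c a b p : Tensor2)
      = -((e p).transpose * ((ϖ c p).transpose * F₀ + F₀ * ϖ c p) * e p) := by
    rw [h1, h2, h3, hF.self_of_nhds]
    simp only [Matrix.transpose_sub, Matrix.transpose_mul, Matrix.mul_add, Matrix.mul_sub,
      Matrix.add_mul, Matrix.sub_mul, Matrix.mul_assoc]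
    abel
  exact congrFun (congrFun h4 a) b

/-- Covariant derivative of the one-form with frame components `z`. -/
theorem covDeriv1_eq {u z : Pt → Pt} (hz : ∀ α, DifferentiableAt ℝ (fun q => z q α) p)
    (hu : ∀ᶠ q in 𝓝 p, ∀ j, u q j = ∑ α, e q α j * z q α) (i j : Fin 4) :
    covDeriv1 g u i j p
      = ∑ α, e p α j * (pderiv i (fun q => z q α) p - ∑ β, ϖ i p β α * z p β) := by
  have h1 : pderiv i (fun q => u q j) p = ∑ α, (mpderiv i e p α j * z p α
      + e p α j * pderiv i (fun q => z q α) p) := by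
    rw [pderiv_congr (hu.mono fun q hq => hq j),
      pderiv_sum fun α _ => (h.mdiff hp α j).fun_mul (hz α)]
    exact Finset.sum_congr rfl fun α _ => pderiv_mul (h.mdiff hp α j) (hz α)
  have h2 : ∑ k, christoffel g k i j p * u p k
      = ∑ α, (mpderiv i e p + ϖ i p * e p) α j * z p α := by
    simp only [hu.self_of_nhds, ← h.christoffel_eq hp, Matrix.mul_apply, Finset.mul_sum,
      Finset.sum_mul]
    rw [Finset.sum_comm]
    refine Finset.sum_congr rfl fun α _ => Finset.sum_congr rfl fun k _ => ?_
    simp only [christoffelMat, Matrix.of_apply]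
    ring
  rw [covDeriv1, h1, h2, ← Finset.sum_sub_distrib]
  simp only [Matrix.add_apply, Matrix.mul_apply, add_mul, Finset.sum_mul, mul_sub, Finset.mul_sum,
    Finset.sum_sub_distrib, Finset.sum_add_distrib]
  rw [Finset.sum_comm (f := fun α β => e p α j * (ϖ i p β α * z p β))]
  have : ∀ x y, ϖ i p x y * e p y j * z p x = e p y j * (ϖ i p x y * z p x) := fun x y => by ring
  simp only [this]
  ring

end MovingFrame

/-! ### Pulling back a connection along a map -/

/-- The pullback `Φ^* ϖ` of matrix-valued connection forms. -/
def pullConn (ϖ : Fin 4 → Pt → Tensor2) (Φ : Pt → Pt) (i : Fin 4) (p : Pt) : Tensor2 :=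
  ∑ k, jacobian Φ p k i • ϖ k (Φ p)

theorem pullConn_apply (ϖ : Fin 4 → Pt → Tensor2) (Φ : Pt → Pt) (i : Fin 4) (p : Pt) (a b : Fin 4) :
    pullConn ϖ Φ i p a b = ∑ k, jacobian Φ p k i * ϖ k (Φ p) a b := by
  simp [pullConn, Matrix.sum_apply]

section Pull
variable {Φ : Pt → Pt} {p : Pt}

theorem mdiffAt_jacobian (hΦ : ContDiffAt ℝ 3 Φ p) : MDiffAt (jacobian Φ) p := fun k i =>
  differentiableAt_pderiv ((contDiffAt_pi.1 hΦ k).of_le (by norm_num)) i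

theorem contDiffAt_pderiv {f : Pt → ℝ} (hf : ContDiffAt ℝ 3 f p) (i : Fin 4) :
    ContDiffAt ℝ 2 (pderiv i f) p :=
  (hf.fderiv_right (m := 2) (by norm_num)).clm_apply contDiffAt_const

theorem pderiv_jacobian_comm (hΦ : ContDiffAt ℝ 3 Φ p) (i j k : Fin 4) :
    pderiv i (fun q => jacobian Φ q k j) p = pderiv j (fun q => jacobian Φ q k i) p :=
  pderiv_comm ((contDiffAt_pi.1 hΦ k).of_le (by norm_num)) i j

theorem MDiffAt.comp_map {A : Pt → Tensor2} (hA : MDiffAt A (Φ p)) (hΦ : DifferentiableAt ℝ Φ p) :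
    MDiffAt (fun q => A (Φ q)) p := fun a b => (hA a b).fun_comp' p hΦ

theorem mdiffAt_pullConn {ϖ : Fin 4 → Pt → Tensor2} (hϖ : ∀ k, MDiffAt (ϖ k) (Φ p))
    (hΦ : ContDiffAt ℝ 3 Φ p) (i : Fin 4) : MDiffAt (pullConn ϖ Φ i) p := fun a b => by
  simp only [pullConn_apply]
  exact DifferentiableAt.fun_sum fun k _ => (mdiffAt_jacobian hΦ k i).fun_mul
    (MDiffAt.comp_map (hϖ k) (hΦ.differentiableAt (by norm_num)) a b)

/-- The torsion-free condition is preserved by pullback; the second derivatives of `Φ` cancel by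
symmetry. -/
theorem pull_torsion {e : Pt → Tensor2} {ϖ : Fin 4 → Pt → Tensor2} (he : MDiffAt e (Φ p))
    (hΦ : ContDiffAt ℝ 3 Φ p)
    (ht : ∀ α i j, (mpderiv i e (Φ p) + ϖ i (Φ p) * e (Φ p)) α j
      = (mpderiv j e (Φ p) + ϖ j (Φ p) * e (Φ p)) α i) (α i j : Fin 4) :
    (mpderiv i (fun q => e (Φ q) * jacobian Φ q) p
        + pullConn ϖ Φ i p * (e (Φ p) * jacobian Φ p)) α j
      = (mpderiv j (fun q => e (Φ q) * jacobian Φ q) p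
        + pullConn ϖ Φ j p * (e (Φ p) * jacobian Φ p)) α i := by
  have hΦ1 : DifferentiableAt ℝ Φ p := hΦ.differentiableAt (by norm_num)
  have key : ∀ i j, (mpderiv i (fun q => e (Φ q) * jacobian Φ q) p
        + pullConn ϖ Φ i p * (e (Φ p) * jacobian Φ p)) α j
      = (∑ k, ∑ l, jacobian Φ p k i * jacobian Φ p l j
          * (mpderiv k e (Φ p) + ϖ k (Φ p) * e (Φ p)) α l)
        + ∑ k, e (Φ p) α k * pderiv i (fun q => jacobian Φ q k j) p := by
    intro i j
    rw [mpderiv_mul (MDiffAt.comp_map he hΦ1) (mdiffAt_jacobian hΦ)]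
    have h1 : mpderiv i (fun q => e (Φ q)) p = ∑ k, jacobian Φ p k i • mpderiv k e (Φ p) := by
      ext a b
      simp only [mpderiv, Matrix.of_apply, Matrix.sum_apply, Matrix.smul_apply, smul_eq_mul]
      rw [pderiv_comp (he a b) hΦ1]
      exact Finset.sum_congr rfl fun k _ => mul_comm _ _
    rw [h1, pullConn, ← Matrix.mul_assoc, add_right_comm, ← Matrix.add_mul, Finset.sum_mul,
      ← Finset.sum_add_distrib]
    simp only [Matrix.smul_mul, ← smul_add]
    rw [Matrix.add_apply, Matrix.mul_apply, Matrix.mul_apply]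
    congr 1
    rw [Finset.sum_comm]
    refine Finset.sum_congr rfl fun l _ => ?_
    rw [Matrix.sum_apply, Finset.sum_mul]
    refine Finset.sum_congr rfl fun k _ => ?_
    rw [Matrix.smul_apply, smul_eq_mul]; ring
  rw [key, key, Finset.sum_comm]
  congr 1
  · refine Finset.sum_congr rfl fun l _ => Finset.sum_congr rfl fun k _ => ?_
    rw [ht α k l]; ring
  · exact Finset.sum_congr rfl fun k _ => by rw [pderiv_jacobian_comm hΦ i j k]

/-- The curvature form `dϖ + ϖ ∧ ϖ` commutes with pullback. -/
theorem pull_curvature {ϖ : Fin 4 → Pt → Tensor2} (hϖ : ∀ k, MDiffAt (ϖ k) (Φ p))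
    (hΦ : ContDiffAt ℝ 3 Φ p) (c d : Fin 4) :
    mpderiv c (pullConn ϖ Φ d) p - mpderiv d (pullConn ϖ Φ c) p
        + (pullConn ϖ Φ c p * pullConn ϖ Φ d p - pullConn ϖ Φ d p * pullConn ϖ Φ c p)
      = ∑ k, ∑ l, (jacobian Φ p k c * jacobian Φ p l d) •
        (mpderiv k (ϖ l) (Φ p) - mpderiv l (ϖ k) (Φ p)
          + (ϖ k (Φ p) * ϖ l (Φ p) - ϖ l (Φ p) * ϖ k (Φ p))) := by
  have hΦ1 : DifferentiableAt ℝ Φ p := hΦ.differentiableAt (by norm_num)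
  have h1 : ∀ c d, mpderiv c (pullConn ϖ Φ d) p
      = (∑ l, pderiv c (fun q => jacobian Φ q l d) p • ϖ l (Φ p))
        + ∑ k, ∑ l, (jacobian Φ p k c * jacobian Φ p l d) • mpderiv k (ϖ l) (Φ p) := by
    intro c d
    rw [Finset.sum_comm, ← Finset.sum_add_distrib]
    ext a b
    simp only [mpderiv, Matrix.of_apply, pullConn_apply, Matrix.sum_apply, Matrix.add_apply,
      Matrix.smul_apply, smul_eq_mul]
    rw [pderiv_sum fun l _ => (mdiffAt_jacobian hΦ l d).fun_mul
      (MDiffAt.comp_map (hϖ l) hΦ1 a b)]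
    refine Finset.sum_congr rfl fun l _ => ?_
    rw [pderiv_mul (mdiffAt_jacobian hΦ l d) (MDiffAt.comp_map (hϖ l) hΦ1 a b),
      pderiv_comp (hϖ l a b) hΦ1, Finset.mul_sum]
    congr 1
    exact Finset.sum_congr rfl fun k _ => by ring
  have h2 : ∀ c d, pullConn ϖ Φ c p * pullConn ϖ Φ d p
      = ∑ k, ∑ l, (jacobian Φ p k c * jacobian Φ p l d) • (ϖ k (Φ p) * ϖ l (Φ p)) := by
    intro c d
    simp only [pullConn, Finset.sum_mul, Finset.mul_sum, Matrix.smul_mul, Matrix.mul_smul,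
      smul_smul]
    rw [Finset.sum_comm]
    simp only [mul_comm]
  have h3 : ∀ l, pderiv c (fun q => jacobian Φ q l d) p = pderiv d (fun q => jacobian Φ q l c) p :=
    fun l => pderiv_jacobian_comm hΦ c d l
  rw [h1, h1, h2, h2]
  simp only [h3]
  rw [Finset.sum_comm (f := fun k l =>
      (jacobian Φ p k d * jacobian Φ p l c) • mpderiv k (ϖ l) (Φ p)),
    Finset.sum_comm (f := fun k l =>
      (jacobian Φ p k d * jacobian Φ p l c) • (ϖ k (Φ p) * ϖ l (Φ p)))]
  simp only [smul_add, smul_sub, Finset.sum_add_distrib, Finset.sum_sub_distrib,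
    mul_comm (jacobian Φ p _ d)]
  abel
end Pull

/-! ### A null coframe of the Kerr metric and its connection -/
/-- `u = r / Σ`, the real part of `1 / (r - i a cos θ)`. -/
def kerrU (a : ℝ) (x : Pt) : ℝ := x 1 / kerrSigma a x

/-- `v = a cos θ / Σ`, the imaginary part of `1 / (r - i a cos θ)`. -/
def kerrV (a : ℝ) (x : Pt) : ℝ := a * Real.cos (x 2) / kerrSigma a x

theorem differentiableAt_kerrSigma (a : ℝ) (x : Pt) : DifferentiableAt ℝ (kerrSigma a) x := by
  unfold kerrSigma; fun_prop

theorem differentiableAt_kerrDelta (m a : ℝ) (x : Pt) : DifferentiableAt ℝ (kerrDelta m a) x := by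
  unfold kerrDelta; fun_prop

theorem pderiv_kerrSigma (i : Fin 4) (a : ℝ) (x : Pt) : pderiv i (kerrSigma a) x
   = if i = 1 then 2 * x 1 else
     if i = 2 then -2 * a ^ 2 * Real.cos (x 2) * Real.sin (x 2) else 0 := by
  unfold kerrSigma
  simp (disch := fun_prop) only
    [pderiv_add, pderiv_mul, pderiv_pow, pderiv_const, pderiv_cos, pderiv_coord]
  fin_cases i <;> simp <;> ring

theorem pderiv_kerrDelta (i : Fin 4) (m a : ℝ) (x : Pt) : pderiv i (kerrDelta m a) x
   = if i = 1 then 2 * x 1 - 2 * m else 0 := by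
  unfold kerrDelta
  simp (disch := fun_prop) only
    [pderiv_add, pderiv_sub, pderiv_mul, pderiv_pow, pderiv_const, pderiv_coord]
  fin_cases i <;> simp

theorem differentiableAt_kerrU {a : ℝ} {x : Pt} (h : kerrSigma a x ≠ 0) :
    DifferentiableAt ℝ (kerrU a) x := by
  have := differentiableAt_kerrSigma a x
  unfold kerrU; fun_prop (disch := assumption)

theorem differentiableAt_kerrV {a : ℝ} {x : Pt} (h : kerrSigma a x ≠ 0) :
    DifferentiableAt ℝ (kerrV a) x := by
  have := differentiableAt_kerrSigma a x
  unfold kerrV; fun_prop (disch := assumption)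

theorem pderiv_kerrU (i : Fin 4) {a : ℝ} {x : Pt} (h : kerrSigma a x ≠ 0) : pderiv i (kerrU a) x
   = if i = 1 then kerrV a x ^ 2 - kerrU a x ^ 2 else
     if i = 2 then 2 * a * Real.sin (x 2) * kerrU a x * kerrV a x else 0 := by
  have := differentiableAt_kerrSigma a x
  unfold kerrU kerrV
  simp (disch := first | assumption | fun_prop (disch := assumption)) only
    [div_eq_mul_inv, pderiv_mul, pderiv_inv, pderiv_coord, pderiv_kerrSigma]
  fin_cases i <;> simp <;> field_simp <;> simp only [kerrSigma] <;> ring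

theorem pderiv_kerrV (i : Fin 4) {a : ℝ} {x : Pt} (h : kerrSigma a x ≠ 0) : pderiv i (kerrV a) x
   = if i = 1 then -2 * kerrU a x * kerrV a x else
     if i = 2 then a * Real.sin (x 2) * (kerrV a x ^ 2 - kerrU a x ^ 2) else 0 := by
  have := differentiableAt_kerrSigma a x
  unfold kerrU kerrV
  simp (disch := first | assumption | fun_prop (disch := assumption)) only
    [div_eq_mul_inv, pderiv_mul, pderiv_inv, pderiv_const, pderiv_cos, pderiv_kerrSigma]
  fin_cases i <;> simp <;> field_simp <;> simp only [kerrSigma] <;> ring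

/-- Frame components of the metric: `e⁰, e¹` are null with product `-1`, and `e², e³` are
orthonormal. -/
def frameMetric : Tensor2 := !![0, -1, 0, 0; -1, 0, 0, 0; 0, 0, 1, 0; 0, 0, 0, 1]

/-- The element `X` of the Lie algebra of `frameMetric` whose lowered components `N_{αγ} X^γ_β` are
the skew matrix `b_{αβ}`. -/
def lorentz (b₀₁ b₀₂ b₀₃ b₁₂ b₁₃ b₂₃ : ℝ) : Tensor2 :=
  !![b₀₁, 0, -b₁₂, -b₁₃; 0, -b₀₁, -b₀₂, -b₀₃; -b₀₂, -b₁₂, 0, b₂₃; -b₀₃, -b₁₃, -b₂₃, 0]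

/-- The null coframe of the Kerr metric, one one-form in each row. Here `u² + v² = 1/Σ`, and `1/Σ`
is written in this form to keep the differentiation rules polynomial. -/
def kerrFrame (m a : ℝ) (x : Pt) : Tensor2 :=
  !![1, -(kerrSigma a x * (kerrDelta m a x)⁻¹), 0, -(a * Real.sin (x 2) ^ 2);
     kerrDelta m a x * (kerrU a x ^ 2 + kerrV a x ^ 2) / 2, 1 / 2, 0,
       -(kerrDelta m a x * (kerrU a x ^ 2 + kerrV a x ^ 2) / 2 * (a * Real.sin (x 2) ^ 2));
     -(a * Real.sin (x 2) * kerrV a x), 0, x 1,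
       Real.sin (x 2) * kerrV a x * (x 1 ^ 2 + a ^ 2);
     a * Real.sin (x 2) * kerrU a x, 0, a * Real.cos (x 2),
       -(Real.sin (x 2) * kerrU a x * (x 1 ^ 2 + a ^ 2))]

/-- The connection form `ω(∂_i)` of `kerrFrame`; each vector lists the components in the directions
`t, r, θ, φ`. -/
def kerrConn (m a : ℝ) (i : Fin 4) (x : Pt) : Tensor2 :=
  lorentz
    (![m * (kerrV a x ^ 2 - kerrU a x ^ 2),
      (m * (x 1 * kerrU a x - a * Real.cos (x 2) * kerrV a x)
        - a ^ 2 * Real.sin (x 2) ^ 2 * kerrU a x) * (kerrDelta m a x)⁻¹,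
      a * Real.sin (x 2) * kerrV a x,
      a * Real.sin (x 2) ^ 2 * (m * (kerrU a x ^ 2 - kerrV a x ^ 2) + kerrU a x)] i)
    (![0, a * Real.sin (x 2) * kerrU a x * kerrV a x,
      kerrDelta m a x * (kerrU a x ^ 2 - kerrV a x ^ 2) / 2,
      kerrDelta m a x * Real.sin (x 2) * kerrU a x * kerrV a x] i)
    (![0, a * Real.sin (x 2) * (kerrV a x ^ 2 - kerrU a x ^ 2) / 2,
      kerrDelta m a x * kerrU a x * kerrV a x,
      Real.sin (x 2) * kerrDelta m a x * (kerrV a x ^ 2 - kerrU a x ^ 2) / 2] i)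
    (![0, 0, -1, 0] i)
    (![0, -(a * Real.sin (x 2) * (kerrDelta m a x)⁻¹), 0, Real.sin (x 2)] i)
    (![-(2 * m * kerrU a x * kerrV a x), -kerrV a x, -(a * Real.sin (x 2) * kerrU a x),
      a * Real.sin (x 2) ^ 2 * (2 * m * kerrU a x * kerrV a x + kerrV a x) + Real.cos (x 2)] i)

/-- Real part of `-m (u - i v)³ = -m / (r + i a cos θ)³`. -/
def kerrRe (m a : ℝ) (x : Pt) : ℝ := m * (3 * kerrU a x * kerrV a x ^ 2 - kerrU a x ^ 3)

/-- Imaginary part of `-m (u - i v)³ = -m / (r + i a cos θ)³`. -/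
def kerrIm (m a : ℝ) (x : Pt) : ℝ := m * (3 * kerrU a x ^ 2 * kerrV a x - kerrV a x ^ 3)

theorem lorentz_comm (b c d e f h b' c' d' e' f' h' : ℝ) :
    lorentz b c d e f h * lorentz b' c' d' e' f' h'
      - lorentz b' c' d' e' f' h' * lorentz b c d e f h
    = lorentz (e * c' + f * d' - (e' * c + f' * d)) (c * b' + h * d' - (c' * b + h' * d))
       (d * b' - h * c' - (d' * b - h' * c)) (b * e' - f * h' - (b' * e - f' * h))
       (b * f' + e * h' - (b' * f + e' * h)) (c * f' + e * d' - (c' * f + e' * d)) := by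
  ext i j
  fin_cases i <;> fin_cases j <;> simp [lorentz, Matrix.mul_apply, Fin.sum_univ_four] <;> ring

theorem lorentz_add (b c d e f h b' c' d' e' f' h' : ℝ) :
    lorentz b c d e f h + lorentz b' c' d' e' f' h'
    = lorentz (b + b') (c + c') (d + d') (e + e') (f + f') (h + h') := by
  ext i j; fin_cases i <;> fin_cases j <;> simp [lorentz] <;> ring

theorem lorentz_sub (b c d e f h b' c' d' e' f' h' : ℝ) :
    lorentz b c d e f h - lorentz b' c' d' e' f' h'
    = lorentz (b - b') (c - c') (d - d') (e - e') (f - f') (h - h') := by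
  ext i j; fin_cases i <;> fin_cases j <;> simp [lorentz] <;> ring

theorem mpderiv_lorentz (i : Fin 4) (b c d e f h : Pt → ℝ) (p : Pt) :
   mpderiv i (fun q => lorentz (b q) (c q) (d q) (e q) (f q) (h q)) p =
    lorentz (pderiv i b p) (pderiv i c p) (pderiv i d p) (pderiv i e p) (pderiv i f p)
      (pderiv i h p) := by
  ext k l; fin_cases k <;> fin_cases l <;> simp [lorentz, mpderiv, pderiv_neg, pderiv_const]

/-- The Lie algebra value, on a bivector with frame components `B`, of a type D curvature form with
double eigenvalue `α + i β` and principal planes `e⁰ ∧ e¹`, `e² ∧ e³`. -/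
def typeDCurv (α β : ℝ) (B : Fin 4 → Fin 4 → ℝ) : Tensor2 :=
  lorentz (2 * α * B 0 1 - 2 * β * B 2 3) (-α * B 1 2 - β * B 1 3) (β * B 1 2 - α * B 1 3)
    (-α * B 0 2 + β * B 0 3) (-β * B 0 2 - α * B 0 3) (-2 * β * B 0 1 - 2 * α * B 2 3)

set_option maxHeartbeats 4000000 in
/-- The curvature of `kerrConn`. It suffices to consider `i < j`; the other cases follow by skewness
in `kerr_curvature`. -/
theorem kerr_curvature_of_lt {m a : ℝ} {x : Pt} (hx : kerrSigma a x ≠ 0)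
    (hx' : kerrDelta m a x ≠ 0) :
    ∀ i j, i < j → mpderiv i (kerrConn m a j) x - mpderiv j (kerrConn m a i) x
     + (kerrConn m a i x * kerrConn m a j x - kerrConn m a j x * kerrConn m a i x) =
     typeDCurv (kerrRe m a x) (kerrIm m a x) (fun γ δ => kerrFrame m a x γ i * kerrFrame m a x δ j
      - kerrFrame m a x δ i * kerrFrame m a x γ j) := by
  have h1 := differentiableAt_kerrSigma a x
  have h2 := differentiableAt_kerrDelta m a x
  have h3 := differentiableAt_kerrU hx
  have h4 := differentiableAt_kerrV hx
  have hs := Real.sin_sq_add_cos_sq (x 2)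
  have hS : kerrSigma a x = x 1 ^ 2 + a ^ 2 * Real.cos (x 2) ^ 2 := rfl
  have hD : kerrDelta m a x = x 1 ^ 2 - 2 * m * x 1 + a ^ 2 := rfl
  have hu : kerrU a x = x 1 / kerrSigma a x := rfl
  have hv : kerrV a x = a * Real.cos (x 2) / kerrSigma a x := rfl
  intro i j hij
  unfold kerrConn typeDCurv
  simp only [mpderiv_lorentz, lorentz_comm, lorentz_add, lorentz_sub]
  fin_cases i <;> fin_cases j <;> first | (exfalso; revert hij; decide) | skip
  all_goals
    congr 1 <;> simp [kerrFrame, kerrRe, kerrIm] <;>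
    simp (disch := first | assumption | fun_prop (disch := assumption)) [
      div_eq_mul_inv, pderiv_add, pderiv_sub, pderiv_mul, pderiv_inv, pderiv_const, pderiv_cos,
      pderiv_sin, pderiv_coord, pderiv_kerrSigma, pderiv_kerrDelta, pderiv_kerrU, pderiv_kerrV,
      pderiv_neg, pderiv_pow]
  all_goals
    -- With the transcendental functions replaced by variables, the claim is a rational identity
    -- modulo the relations `hs`, `hS`, `hD`.
    clear h1 h2 h3 h4
    try rw [hu]
    try rw [hv]
    clear hu hv
    generalize kerrSigma a x = Sg at *
    generalize kerrDelta m a x = Dl at *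
    generalize Real.sin (x 2) = s at *
    generalize Real.cos (x 2) = c at *
    generalize x 1 = r at *
    try field_simp
    try grind

/-- Frame components of the two-form `e⁰ ∧ e¹`. -/
def planeForm : Tensor2 := !![0, 1, 0, 0; -1, 0, 0, 0; 0, 0, 0, 0; 0, 0, 0, 0]

/-- Frame components of `-e² ∧ e³`, the Hodge dual of `e⁰ ∧ e¹` when the frame is positively
oriented. -/
def planeDual : Tensor2 := !![0, 0, 0, 0; 0, 0, 0, 0; 0, 0, 0, -1; 0, 0, 1, 0]

/-- The frame of vectors dual to `kerrFrame`, one vector in each column. -/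
def kerrDual (m a : ℝ) (x : Pt) : Tensor2 :=
  let u := kerrU a x
  let v := kerrV a x
  let s := Real.sin (x 2)
  !![(1 + a * s ^ 2 * (a * (u ^ 2 + v ^ 2))) / 2, (x 1 ^ 2 + a ^ 2) * (kerrDelta m a x)⁻¹,
       a * s * v, -(a * s * u);
     -(kerrDelta m a x * (u ^ 2 + v ^ 2) / 2), 1, 0, 0;
     0, 0, u, v;
     a * (u ^ 2 + v ^ 2) / 2, a * (kerrDelta m a x)⁻¹, v / s, -(u / s)]

/-- Frame components of the one-form metrically equivalent to `∂_t`. -/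
def kerrTime (m a : ℝ) (x : Pt) : Pt :=
  ![-(kerrDelta m a x * (kerrU a x ^ 2 + kerrV a x ^ 2) / 2), -1, -(a * Real.sin (x 2) * kerrV a x),
    a * Real.sin (x 2) * kerrU a x]

theorem kerrTime_eq (m a : ℝ) (x : Pt) (α : Fin 4) :
    kerrTime m a x α = (frameMetric * kerrFrame m a x) α 0 := by
  fin_cases α <;> simp [kerrTime, frameMetric, kerrFrame, Matrix.mul_apply, Fin.sum_univ_four]

theorem kerrMetric_eq {m a : ℝ} {x : Pt} (hx : kerrSigma a x ≠ 0) (hx' : kerrDelta m a x ≠ 0) :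
    kerrMetric m a x = (kerrFrame m a x).transpose * frameMetric * kerrFrame m a x := by
  have hs := Real.sin_sq_add_cos_sq (x 2)
  have hS : kerrSigma a x = x 1 ^ 2 + a ^ 2 * Real.cos (x 2) ^ 2 := rfl
  have hD : kerrDelta m a x = x 1 ^ 2 - 2 * m * x 1 + a ^ 2 := rfl
  have hu : kerrU a x = x 1 / kerrSigma a x := rfl
  have hv : kerrV a x = a * Real.cos (x 2) / kerrSigma a x := rfl
  ext i j
  fin_cases i <;> fin_cases j <;> 
    simp [kerrMetric, frameMetric, kerrFrame, Matrix.mul_apply, Fin.sum_univ_four]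
  all_goals
    try rw [hu]
    try rw [hv]
    clear hu hv
    generalize kerrSigma a x = Sg at *
    generalize kerrDelta m a x = Dl at *
    generalize Real.sin (x 2) = s at *
    generalize Real.cos (x 2) = c at *
    generalize x 1 = r at *
    try field_simp
    try grind

theorem kerrFrame_mul_dual {m a : ℝ} {x : Pt} (hx : kerrSigma a x ≠ 0) (hx' : kerrDelta m a x ≠ 0)
    (hx'' : Real.sin (x 2) ≠ 0) :
    kerrFrame m a x * kerrDual m a x = 1 := by
  have hs := Real.sin_sq_add_cos_sq (x 2)
  have hS : kerrSigma a x = x 1 ^ 2 + a ^ 2 * Real.cos (x 2) ^ 2 := rfl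
  have hD : kerrDelta m a x = x 1 ^ 2 - 2 * m * x 1 + a ^ 2 := rfl
  have hu : kerrU a x = x 1 / kerrSigma a x := rfl
  have hv : kerrV a x = a * Real.cos (x 2) / kerrSigma a x := rfl
  ext i j
  fin_cases i <;> fin_cases j <;> simp [kerrDual, kerrFrame, Matrix.mul_apply, Fin.sum_univ_four]
  all_goals
    try rw [hu]
    try rw [hv]
    clear hu hv
    generalize kerrSigma a x = Sg at *
    generalize kerrDelta m a x = Dl at *
    generalize Real.sin (x 2) = s at *
    generalize Real.cos (x 2) = c at *
    generalize x 1 = r at *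
    try field_simp
    try grind

/-- The codifferentials of `e⁰ ∧ e¹` and `-e² ∧ e³` are `-2u` and `-2v` times the one-form of
`∂_t`. -/
theorem kerr_codiff {m a : ℝ} {x : Pt} (hx : kerrSigma a x ≠ 0) (hx' : kerrDelta m a x ≠ 0)
    (hx'' : Real.sin (x 2) ≠ 0) (β : Fin 4) :
    (∑ k, ∑ α, (kerrDual m a x * frameMetric) k α *
     ((kerrConn m a k x).transpose * planeForm + planeForm * kerrConn m a k x) α β) =
      -2 * kerrU a x * kerrTime m a x β ∧
    (∑ k, ∑ α, (kerrDual m a x * frameMetric) k α *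
     ((kerrConn m a k x).transpose * planeDual + planeDual * kerrConn m a k x) α β) =
      -2 * kerrV a x * kerrTime m a x β := by
  have hs := Real.sin_sq_add_cos_sq (x 2)
  have hS : kerrSigma a x = x 1 ^ 2 + a ^ 2 * Real.cos (x 2) ^ 2 := rfl
  have hD : kerrDelta m a x = x 1 ^ 2 - 2 * m * x 1 + a ^ 2 := rfl
  have hu : kerrU a x = x 1 / kerrSigma a x := rfl
  have hv : kerrV a x = a * Real.cos (x 2) / kerrSigma a x := rfl
  constructor <;> fin_cases β <;> 
    simp [kerrDual, frameMetric, planeForm, planeDual, kerrTime, kerrConn, lorentz,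
      Matrix.mul_apply, Fin.sum_univ_four]
  all_goals
    try rw [hu]
    try rw [hv]
    clear hu hv
    generalize kerrSigma a x = Sg at *
    generalize kerrDelta m a x = Dl at *
    generalize Real.sin (x 2) = s at *
    generalize Real.cos (x 2) = c at *
    generalize x 1 = r at *
    try field_simp
    try grind

/-- The Killing equation for `∂_t`, with one index of the covariant derivative in the frame. -/
theorem kerr_killing {m a : ℝ} {x : Pt} (hx : kerrSigma a x ≠ 0) (hx' : kerrDelta m a x ≠ 0)
    (k j : Fin 4) :
    (∑ α, (pderiv k (fun q => kerrTime m a q α) x - ∑ β, kerrConn m a k x β α * kerrTime m a x β)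
      * kerrFrame m a x α j) +
    (∑ α, (pderiv j (fun q => kerrTime m a q α) x - ∑ β, kerrConn m a j x β α * kerrTime m a x β)
      * kerrFrame m a x α k) = 0 := by
  wlog hkj : k ≤ j generalizing k j
  · rw [add_comm]; exact this j k (le_of_not_ge hkj)
  have h1 := differentiableAt_kerrSigma a x
  have h2 := differentiableAt_kerrDelta m a x
  have h3 := differentiableAt_kerrU hx
  have h4 := differentiableAt_kerrV hx
  have hs := Real.sin_sq_add_cos_sq (x 2)
  have hS : kerrSigma a x = x 1 ^ 2 + a ^ 2 * Real.cos (x 2) ^ 2 := rfl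
  have hD : kerrDelta m a x = x 1 ^ 2 - 2 * m * x 1 + a ^ 2 := rfl
  have hu : kerrU a x = x 1 / kerrSigma a x := rfl
  have hv : kerrV a x = a * Real.cos (x 2) / kerrSigma a x := rfl
  fin_cases k <;> fin_cases j <;> first | (exfalso; revert hkj; decide) | skip
  all_goals
    simp [kerrFrame, kerrConn, lorentz, kerrTime, Fin.sum_univ_four] <;>
    simp (disch := first | assumption | fun_prop (disch := assumption)) [
      div_eq_mul_inv, pderiv_add, pderiv_mul, pderiv_const, pderiv_sin, pderiv_kerrDelta,
      pderiv_kerrU, pderiv_kerrV, pderiv_neg, pderiv_pow]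
  all_goals
    clear h1 h2 h3 h4
    try rw [hu]
    try rw [hv]
    clear hu hv
    generalize kerrSigma a x = Sg at *
    generalize kerrDelta m a x = Dl at *
    generalize Real.sin (x 2) = s at *
    generalize Real.cos (x 2) = c at *
    generalize x 1 = r at *
    try field_simp
    try grind

/-- The first structure equation of the Kerr coframe; see `kerr_torsion` for all pairs of
indices. -/
theorem kerr_torsion_of_lt {m a : ℝ} {x : Pt} (hx : kerrSigma a x ≠ 0) (hx' : kerrDelta m a x ≠ 0)
    (α : Fin 4) :
    ∀ i j, i < j →
      pderiv i (fun q => kerrFrame m a q α j) x - pderiv j (fun q => kerrFrame m a q α i) x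
        + ((kerrConn m a i x * kerrFrame m a x) α j
          - (kerrConn m a j x * kerrFrame m a x) α i) = 0 := by
  have h1 := differentiableAt_kerrSigma a x
  have h2 := differentiableAt_kerrDelta m a x
  have h3 := differentiableAt_kerrU hx
  have h4 := differentiableAt_kerrV hx
  have hs := Real.sin_sq_add_cos_sq (x 2)
  have hS : kerrSigma a x = x 1 ^ 2 + a ^ 2 * Real.cos (x 2) ^ 2 := rfl
  have hD : kerrDelta m a x = x 1 ^ 2 - 2 * m * x 1 + a ^ 2 := rfl
  have hu : kerrU a x = x 1 / kerrSigma a x := rfl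
  have hv : kerrV a x = a * Real.cos (x 2) / kerrSigma a x := rfl
  intro i j hij
  fin_cases i <;> fin_cases j <;> first | (exfalso; revert hij; decide) | skip
  all_goals
    fin_cases α <;> simp [kerrFrame, kerrConn, lorentz, Matrix.mul_apply, Fin.sum_univ_four] <;>
    simp (disch := first | assumption | fun_prop (disch := assumption)) [
      div_eq_mul_inv, pderiv_add, pderiv_mul, pderiv_inv, pderiv_const, pderiv_cos, pderiv_sin,
      pderiv_coord, pderiv_kerrSigma, pderiv_kerrDelta, pderiv_kerrU, pderiv_kerrV, pderiv_neg,
      pderiv_pow]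
  all_goals
    clear h1 h2 h3 h4
    try rw [hu]
    try rw [hv]
    clear hu hv
    generalize kerrSigma a x = Sg at *
    generalize kerrDelta m a x = Dl at *
    generalize Real.sin (x 2) = s at *
    generalize Real.cos (x 2) = c at *
    generalize x 1 = r at *
    try field_simp
    try grind

theorem kerr_torsion {m a : ℝ} {x : Pt} (hx : x ∈ kerrDomain m a) (α i j : Fin 4) :
    (mpderiv i (kerrFrame m a) x + kerrConn m a i x * kerrFrame m a x) α j
      = (mpderiv j (kerrFrame m a) x + kerrConn m a j x * kerrFrame m a x) α i := by
  simp only [Matrix.add_apply, mpderiv, Matrix.of_apply]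
  rcases lt_trichotomy i j with h | h | h
  · linear_combination kerr_torsion_of_lt hx.1 hx.2.1 α i j h
  · rw [h]
  · linear_combination -kerr_torsion_of_lt hx.1 hx.2.1 α j i h

theorem lorentz_skew (b c d e f h : ℝ) :
    (lorentz b c d e f h).transpose * frameMetric + frameMetric * lorentz b c d e f h = 0 := by
  ext i j
  fin_cases i <;> fin_cases j <;>
    simp [lorentz, frameMetric, Matrix.mul_apply, Fin.sum_univ_four]

theorem contDiffAt_kerrFrame {m a : ℝ} {x : Pt} (hx : x ∈ kerrDomain m a) (α i : Fin 4) :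
    ContDiffAt ℝ 2 (fun y => kerrFrame m a y α i) x := by
  obtain ⟨h1, h2, h3⟩ := hx
  have hS : ContDiffAt ℝ 2 (kerrSigma a) x := by unfold kerrSigma; fun_prop
  have hD : ContDiffAt ℝ 2 (kerrDelta m a) x := by unfold kerrDelta; fun_prop
  have hU : ContDiffAt ℝ 2 (kerrU a) x := by unfold kerrU; exact ContDiffAt.div (by fun_prop) hS h1
  have hV : ContDiffAt ℝ 2 (kerrV a) x := by unfold kerrV; exact ContDiffAt.div (by fun_prop) hS h1
  have hDi : ContDiffAt ℝ 2 (fun y => (kerrDelta m a y)⁻¹) x := hD.inv h2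
  fin_cases α <;> fin_cases i <;> simp [kerrFrame] <;> fun_prop

theorem mdiffAt_kerrConn {m a : ℝ} {x : Pt} (hx : x ∈ kerrDomain m a) (i : Fin 4) :
    MDiffAt (kerrConn m a i) x := by
  obtain ⟨h1, h2, h3⟩ := hx
  have hS := differentiableAt_kerrSigma a x
  have hD := differentiableAt_kerrDelta m a x
  have hU := differentiableAt_kerrU h1
  have hV := differentiableAt_kerrV h1
  have hDi : DifferentiableAt ℝ (fun y => (kerrDelta m a y)⁻¹) x := hD.fun_inv h2
  intro α β
  fin_cases i <;> fin_cases α <;> fin_cases β <;> simp [kerrConn, lorentz] <;> fun_prop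

theorem det_kerrFrame_ne {m a : ℝ} {x : Pt} (hx : x ∈ kerrDomain m a) :
    (kerrFrame m a x).det ≠ 0 := by
  have := congrArg Matrix.det (kerrFrame_mul_dual hx.1 hx.2.1 hx.2.2)
  rw [Matrix.det_mul, Matrix.det_one] at this
  exact left_ne_zero_of_mul_eq_one this

theorem kerr_curvature {m a : ℝ} {x : Pt} (hx : x ∈ kerrDomain m a) (i j : Fin 4) :
    mpderiv i (kerrConn m a j) x - mpderiv j (kerrConn m a i) x
     + (kerrConn m a i x * kerrConn m a j x - kerrConn m a j x * kerrConn m a i x) =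
     typeDCurv (kerrRe m a x) (kerrIm m a x) (fun γ δ => kerrFrame m a x γ i * kerrFrame m a x δ j
      - kerrFrame m a x δ i * kerrFrame m a x γ j) := by
  rcases lt_trichotomy i j with h | h | h
  · exact kerr_curvature_of_lt hx.1 hx.2.1 i j h
  · subst h
    have : typeDCurv (kerrRe m a x) (kerrIm m a x) (fun γ δ =>
      kerrFrame m a x γ i * kerrFrame m a x δ i
        - kerrFrame m a x δ i * kerrFrame m a x γ i) = 0 := by
      have e1 : ∀ γ δ, kerrFrame m a x γ i * kerrFrame m a x δ i
        - kerrFrame m a x δ i * kerrFrame m a x γ i = 0 := fun γ δ => by ring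
      simp only [e1, typeDCurv]
      ext k l
      fin_cases k <;> fin_cases l <;> simp [lorentz]
    rw [this]; abel
  · have e1 := kerr_curvature_of_lt hx.1 hx.2.1 j i h
    have e2 : ∀ (B : Fin 4 → Fin 4 → ℝ) s t,
        typeDCurv s t (fun γ δ => -B γ δ) = -typeDCurv s t B := by
      intro B s t
      ext k l
      fin_cases k <;> fin_cases l <;> simp [lorentz, typeDCurv] <;> ring
    have e3 : ∀ γ δ, kerrFrame m a x γ i * kerrFrame m a x δ j
      - kerrFrame m a x δ i * kerrFrame m a x γ j = -(kerrFrame m a x γ j * kerrFrame m a x δ i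
      - kerrFrame m a x δ j * kerrFrame m a x γ i) := fun γ δ => by ring
    simp only [e3]
    rw [e2, ← e1]
    abel

/-! ### Algebra of double two-forms -/

section PointAlgebra

variable {M : Tensor2}

/-- The tensor product `A ⊗ B` of two two-forms, as a double two-form. -/
def outer (A B : Tensor2) : Tensor4 := fun a b c d => A a b * B c d

/-- The metric product `½ A^{mn} B_{mn}` of two-forms. -/
def pair2 (M A B : Tensor2) : ℝ :=
  (1 / 2) * ∑ m, ∑ n, A m n * (M⁻¹ * B * M⁻¹.transpose) m n

/-- Raising both indices, `X^{mn}`, written as a matrix product. -/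
theorem raise_apply (X : Tensor2) (m n : Fin 4) :
    (M⁻¹ * X * M⁻¹.transpose) m n = ∑ k, ∑ l, M⁻¹ m k * M⁻¹ n l * X k l := by
  rw [Matrix.mul_apply, Finset.sum_comm]
  refine Finset.sum_congr rfl fun l _ => ?_
  rw [Matrix.mul_apply, Finset.sum_mul]
  refine Finset.sum_congr rfl fun k _ => ?_
  rw [Matrix.transpose_apply]; ring

theorem act4_apply (P : Tensor4) (X : Tensor2) (a b : Fin 4) :
    act4 M P X a b = (1 / 2) * ∑ m, ∑ n, P a b m n * (M⁻¹ * X * M⁻¹.transpose) m n := by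
  simp only [act4, raise_apply, Finset.mul_sum]
  simp only [mul_assoc]

theorem comp4_apply (P Q : Tensor4) (a b c d : Fin 4) :
    comp4 M P Q a b c d = act4 M P (Matrix.of fun k l => Q k l c d) a b := rfl

theorem act4_outer (A B X : Tensor2) : act4 M (outer A B) X = pair2 M B X • A := by
  ext a b
  simp only [act4_apply, outer, pair2, Matrix.smul_apply, smul_eq_mul, mul_assoc, ← Finset.mul_sum]
  ring

theorem act4_add (P Q : Tensor4) (X : Tensor2) : act4 M (P + Q) X = act4 M P X + act4 M Q X := by
  ext a b
  simp only [act4_apply, Pi.add_apply, Matrix.add_apply, add_mul, mul_add, Finset.sum_add_distrib]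

theorem act4_smul (t : ℝ) (P : Tensor4) (X : Tensor2) : act4 M (t • P) X = t • act4 M P X := by
  ext a b
  simp only [act4_apply, Pi.smul_apply, Matrix.smul_apply, smul_eq_mul, mul_assoc,
    ← Finset.mul_sum]
  ring

theorem act4_add_right (P : Tensor4) (X Y : Tensor2) :
    act4 M P (X + Y) = act4 M P X + act4 M P Y := by
  ext a b
  simp only [act4_apply, Matrix.add_apply, Matrix.add_mul, mul_add,
    Finset.sum_add_distrib]

theorem act4_smul_right (t : ℝ) (P : Tensor4) (X : Tensor2) :
    act4 M P (t • X) = t • act4 M P X := by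
  ext a b
  simp only [act4_apply, Matrix.smul_apply, Matrix.mul_smul, Matrix.smul_mul, smul_eq_mul,
    mul_left_comm _ t, ← Finset.mul_sum]

theorem pair2_add_right (A X Y : Tensor2) : pair2 M A (X + Y) = pair2 M A X + pair2 M A Y := by
  simp only [pair2, Matrix.add_apply, Matrix.add_mul, mul_add,
    Finset.sum_add_distrib]

theorem pair2_smul_right (t : ℝ) (A X : Tensor2) : pair2 M A (t • X) = t * pair2 M A X := by
  simp only [pair2, Matrix.smul_apply, Matrix.mul_smul, Matrix.smul_mul, smul_eq_mul,
    mul_left_comm _ t, ← Finset.mul_sum]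

theorem pair2_add_left (A B X : Tensor2) : pair2 M (A + B) X = pair2 M A X + pair2 M B X := by
  simp only [pair2, Matrix.add_apply, add_mul, mul_add, Finset.sum_add_distrib]

theorem pair2_smul_left (t : ℝ) (A X : Tensor2) : pair2 M (t • A) X = t * pair2 M A X := by
  simp only [pair2, Matrix.smul_apply, smul_eq_mul, mul_assoc, mul_left_comm _ t, ← Finset.mul_sum]

/-- The two-form `G_{··cd}`. -/
def metricForm (M : Tensor2) (c d : Fin 4) : Tensor2 := Matrix.of fun k l => metricG M k l c d

/-- The two-form `η_{··cd}`. -/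
def volForm (M : Tensor2) (c d : Fin 4) : Tensor2 := Matrix.of fun k l => volEl M k l c d

theorem raise_metricForm (hdet : M.det ≠ 0) (c d m n : Fin 4) :
    (M⁻¹ * metricForm M c d * M⁻¹.transpose) m n
      = (if m = c ∧ n = d then 1 else 0) - (if m = d ∧ n = c then 1 else 0) := by
  have h1 : ∀ a b, ∑ k, M⁻¹ a k * M k b = if a = b then 1 else 0 := fun a b => by
    rw [← Matrix.mul_apply, Matrix.nonsing_inv_mul _ hdet.isUnit, Matrix.one_apply]
  have h2 : ∀ a b, ∑ k, ∑ l, M⁻¹ m k * M⁻¹ n l * (M k a * M l b)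
      = if m = a ∧ n = b then 1 else 0 := fun a b => by
    have h3 : ∑ k, ∑ l, M⁻¹ m k * M⁻¹ n l * (M k a * M l b)
        = (∑ k, M⁻¹ m k * M k a) * ∑ l, M⁻¹ n l * M l b := by
      rw [Finset.sum_mul_sum]
      exact Finset.sum_congr rfl fun k _ => Finset.sum_congr rfl fun l _ => by ring
    rw [h3, h1, h1]
    split_ifs <;> simp_all
  rw [raise_apply, ← h2 c d, ← h2 d c]
  simp only [metricForm, Matrix.of_apply, metricG, mul_sub, Finset.sum_sub_distrib]

theorem act4_metricForm (hdet : M.det ≠ 0) {P : Tensor4} (c d a b : Fin 4) :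
    act4 M P (metricForm M c d) a b = (1 / 2) * (P a b c d - P a b d c) := by
  rw [act4_apply]
  simp [raise_metricForm hdet, mul_sub, ite_and]

theorem pair2_metricForm (hdet : M.det ≠ 0) {A : Tensor2} (hA : A.transpose = -A) (c d : Fin 4) :
    pair2 M A (metricForm M c d) = A c d := by
  have : A d c = - A c d := congrFun (congrFun hA c) d
  simp only [pair2, raise_metricForm hdet]
  simp [mul_sub, ite_and, this]
  ring

theorem act4_metricG (hM : M.transpose = M) (hdet : M.det ≠ 0) {X : Tensor2}
    (hX : X.transpose = -X) : act4 M (metricG M) X = X := by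
  have h1 : M * (M⁻¹ * X * M⁻¹.transpose) * M = X := by
    have h2 : M⁻¹.transpose * M = 1 := by
      rw [Matrix.transpose_nonsing_inv, hM, Matrix.nonsing_inv_mul _ hdet.isUnit]
    rw [Matrix.mul_assoc M, Matrix.mul_assoc (M⁻¹ * X), h2, Matrix.mul_one, ← Matrix.mul_assoc,
      Matrix.mul_nonsing_inv _ hdet.isUnit, Matrix.one_mul]
  have h2 : ∀ Y : Tensor2, ∀ a b, ∑ m, ∑ n, M a m * M b n * Y m n = (M * Y * M) a b := by
    intro Y a b
    rw [Matrix.mul_apply, Finset.sum_comm]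
    refine Finset.sum_congr rfl fun n _ => ?_
    rw [Matrix.mul_apply, Finset.sum_mul]
    refine Finset.sum_congr rfl fun m _ => ?_
    rw [show M b n = M n b from congrFun (congrFun hM n) b]; ring
  ext a b
  have h3 : X b a = - X a b := congrFun (congrFun hX a) b
  rw [act4_apply]
  have h4 : ∀ Y : Tensor2, ∑ m, ∑ n, M a n * M b m * Y m n = (M * Y * M) b a := fun Y => by
    rw [← h2]
    exact Finset.sum_congr rfl fun m _ => Finset.sum_congr rfl fun n _ => by ring
  simp only [metricG, sub_mul, Finset.sum_sub_distrib, h4, h2, h1]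
  rw [h3]; ring

theorem epsilon_swap_fst (a b c d : Fin 4) : epsilon b a c d = -epsilon a b c d := by
  unfold epsilon
  have h := Matrix.det_permute (Equiv.swap (0 : Fin 4) 1)
    (Matrix.of ![basisVec a, basisVec b, basisVec c, basisVec d])
  rw [Equiv.Perm.sign_swap (by decide)] at h
  simp only [Units.val_neg, Units.val_one, Int.cast_neg, Int.cast_one, neg_mul, one_mul] at h
  rw [← h]
  congr 1
  ext i j
  fin_cases i <;> rfl

theorem epsilon_swap_mid (a b c d : Fin 4) : epsilon c b a d = -epsilon a b c d := by
  unfold epsilon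
  have h := Matrix.det_permute (Equiv.swap (0 : Fin 4) 2)
    (Matrix.of ![basisVec a, basisVec b, basisVec c, basisVec d])
  rw [Equiv.Perm.sign_swap (by decide)] at h
  simp only [Units.val_neg, Units.val_one, Int.cast_neg, Int.cast_one, neg_mul, one_mul] at h
  rw [← h]
  congr 1
  ext i j
  fin_cases i <;> rfl

theorem epsilon_swap_snd (a b c d : Fin 4) : epsilon a d c b = -epsilon a b c d := by
  unfold epsilon
  have h := Matrix.det_permute (Equiv.swap (1 : Fin 4) 3)
    (Matrix.of ![basisVec a, basisVec b, basisVec c, basisVec d])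
  rw [Equiv.Perm.sign_swap (by decide)] at h
  simp only [Units.val_neg, Units.val_one, Int.cast_neg, Int.cast_one, neg_mul, one_mul] at h
  rw [← h]
  congr 1
  ext i j
  fin_cases i <;> rfl

theorem volEl_pair_symm (a b c d : Fin 4) : volEl M a b c d = volEl M c d a b := by
  have : epsilon a b c d = epsilon c d a b := by
    rw [← neg_neg (epsilon a b c d), ← epsilon_swap_mid, ← epsilon_swap_snd]
  rw [volEl, volEl, this]

theorem volEl_swap_fst (a b c d : Fin 4) : volEl M b a c d = -volEl M a b c d := by
  rw [volEl, volEl, epsilon_swap_fst]; ring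

theorem volEl_swap_mid (a b c d : Fin 4) : volEl M c b a d = -volEl M a b c d := by
  rw [volEl, volEl, epsilon_swap_mid]; ring

theorem volEl_swap_last (a b c d : Fin 4) : volEl M a b d c = -volEl M a b c d := by
  rw [volEl_pair_symm, volEl_swap_fst, ← volEl_pair_symm]

theorem tr4_volEl (hM : M.transpose = M) : tr4 M (volEl M) = 0 := by
  have hi : ∀ a k, M⁻¹ a k = M⁻¹ k a := fun a k => by
    have : M⁻¹.transpose = M⁻¹ := by rw [Matrix.transpose_nonsing_inv, hM]
    exact congrFun (congrFun this k) a
  have h1 : ∑ a, ∑ b, ∑ k, ∑ l, M⁻¹ a k * M⁻¹ b l * volEl M k l a b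
      = -∑ a, ∑ b, ∑ k, ∑ l, M⁻¹ a k * M⁻¹ b l * volEl M k l a b := by
    conv_lhs =>
      rw [Finset.sum_comm]
      enter [2, b]
      rw [Finset.sum_comm]
    conv_rhs => rw [Finset.sum_comm]
    simp only [← Finset.sum_neg_distrib]
    refine Finset.sum_congr rfl fun b _ => Finset.sum_congr rfl fun k _ =>
      Finset.sum_congr rfl fun a _ => Finset.sum_congr rfl fun l _ => ?_
    rw [volEl_swap_mid, hi]; ring
  rw [tr4]; linarith

theorem tr4_outer (A B : Tensor2) : tr4 M (outer A B) = pair2 M B A := by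
  simp only [tr4, outer, pair2, raise_apply, Finset.mul_sum]
  refine Finset.sum_congr rfl fun a _ => Finset.sum_congr rfl fun b _ =>
    Finset.sum_congr rfl fun k _ => Finset.sum_congr rfl fun l _ => ?_
  ring

theorem tr4_add (P Q : Tensor4) : tr4 M (P + Q) = tr4 M P + tr4 M Q := by
  simp only [tr4, Pi.add_apply, mul_add, Finset.sum_add_distrib]

theorem tr4_smul (t : ℝ) (P : Tensor4) : tr4 M (t • P) = t * tr4 M P := by
  simp only [tr4, Pi.smul_apply, smul_eq_mul, mul_left_comm _ t, ← Finset.mul_sum]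

theorem tr4_metricG (hdet : M.det ≠ 0) : tr4 M (metricG M) = 6 := by
  have h : tr4 M (metricG M)
      = (1 / 2) * ∑ a, ∑ b, (M⁻¹ * metricForm M a b * M⁻¹.transpose) a b := by
    simp only [tr4, raise_apply]; rfl
  rw [h]
  simp only [raise_metricForm hdet, Fin.sum_univ_four]
  norm_num [Fin.ext_iff]
end PointAlgebra

theorem pair2_comm {M : Tensor2} (hM : M.transpose = M) (A B : Tensor2) :
    pair2 M A B = pair2 M B A := by
  have hi : M⁻¹.transpose = M⁻¹ := by rw [Matrix.transpose_nonsing_inv, hM]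
  have h1 : ∀ A B : Tensor2, pair2 M A B
      = (1 / 2) * (A.transpose * (M⁻¹ * B * M⁻¹)).trace := by
    intro A B
    rw [pair2, hi, Finset.sum_comm, Matrix.trace]
    simp only [Matrix.diag_apply, Matrix.mul_apply (M := A.transpose), Matrix.transpose_apply]
  rw [h1, h1, ← Matrix.trace_transpose]
  simp only [Matrix.transpose_mul, hi, Matrix.transpose_transpose, ← Matrix.mul_assoc]
  rw [Matrix.mul_assoc _ M⁻¹ A, Matrix.mul_assoc M⁻¹, Matrix.trace_mul_comm]
  simp only [Matrix.mul_assoc]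

/-- `U` is a unit time-like simple bivector of a Lorentzian metric `M` and `V` its Hodge dual. The
last field is `** = -1` on the coordinate bivectors. -/
structure IsDualPair (M U V : Tensor2) : Prop where
  symm : M.transpose = M
  det_ne : M.det ≠ 0
  skew_left : U.transpose = -U
  skew_right : V.transpose = -V
  pair_left : pair2 M U U = -1
  pair_right : pair2 M V V = 1
  pair_mixed : pair2 M U V = 0
  hodge_left : hodge2 M U = V
  hodge_right : hodge2 M V = -U
  hodge_volForm : ∀ c d, hodge2 M (volForm M c d) = -metricForm M c d

/-- The double two-form `a G + b η + c (U⊗U - V⊗V) + d (U⊗V + V⊗U)`. -/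
def typeD (M U V : Tensor2) (a b c d : ℝ) : Tensor4 :=
  a • metricG M + b • volEl M + c • (outer U U + (-1 : ℝ) • outer V V)
    + d • (outer U V + outer V U)

namespace IsDualPair

variable {M U V : Tensor2} (h : IsDualPair M U V)
include h

theorem pair_mixed_symm : pair2 M V U = 0 := by rw [pair2_comm h.symm, h.pair_mixed]

theorem pair_volForm (A : Tensor2) (c d : Fin 4) :
    pair2 M A (volForm M c d) = hodge2 M A c d := by
  rw [pair2_comm h.symm, pair2, hodge2, act4_apply]
  simp only [volForm, Matrix.of_apply, volEl_pair_symm c d]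

theorem pair_volForm_left (c d : Fin 4) : pair2 M U (volForm M c d) = V c d := by
  rw [h.pair_volForm, h.hodge_left]

theorem pair_volForm_right (c d : Fin 4) : pair2 M V (volForm M c d) = -U c d := by
  rw [h.pair_volForm, h.hodge_right, Matrix.neg_apply]

theorem hodge_metricForm (c d : Fin 4) : hodge2 M (metricForm M c d) = volForm M c d := by
  ext a b
  rw [hodge2, act4_metricForm h.det_ne, volEl_swap_last a b c d, volForm, Matrix.of_apply]
  ring

theorem act4_typeD (a b c d : ℝ) {X : Tensor2} (hX : X.transpose = -X) :
    act4 M (typeD M U V a b c d) X = a • X + b • hodge2 M X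
      + (c * pair2 M U X + d * pair2 M V X) • U + (d * pair2 M U X - c * pair2 M V X) • V := by
  simp only [typeD, act4_add, act4_smul, act4_outer, act4_metricG h.symm h.det_ne hX, hodge2]
  module

omit h in
theorem typeD_column (a b c d : ℝ) (k l : Fin 4) :
    (Matrix.of fun i j => typeD M U V a b c d i j k l : Tensor2) = a • metricForm M k l
      + b • volForm M k l + (c * U k l + d * V k l) • U + (d * U k l - c * V k l) • V := by
  ext i j
  simp [typeD, metricForm, volForm, outer]
  ring

omit h in
theorem skew_metricForm (k l : Fin 4) : (metricForm M k l).transpose = -metricForm M k l := by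
  ext i j
  simp [metricForm, metricG]
  ring

omit h in
theorem skew_volForm (k l : Fin 4) : (volForm M k l).transpose = -volForm M k l := by
  ext i j
  simp [volForm, volEl_swap_fst j i]

/-- With `* = i` and `P = U⊗U - V⊗V`, `P² = -P`, this is the product
`(z + ζP)(z' + ζ'P) = zz' + (zζ' + ζz' - ζζ')P` of complex numbers `z = a + ib`, `ζ = c + id`. -/
theorem comp4_typeD (a b c d a' b' c' d' : ℝ) :
    comp4 M (typeD M U V a b c d) (typeD M U V a' b' c' d')
      = typeD M U V (a * a' - b * b') (a * b' + b * a')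
        (a * c' - b * d' + c * a' - d * b' - (c * c' - d * d'))
        (a * d' + b * c' + c * b' + d * a' - (c * d' + d * c')) := by
  ext i j k l
  rw [comp4_apply, typeD_column]
  have hs : (a' • metricForm M k l + b' • volForm M k l + (c' * U k l + d' * V k l) • U
      + (d' * U k l - c' * V k l) • V).transpose = -(a' • metricForm M k l + b' • volForm M k l
        + (c' * U k l + d' * V k l) • U + (d' * U k l - c' * V k l) • V) := by
    simp only [Matrix.transpose_add, Matrix.transpose_smul, skew_metricForm, skew_volForm,
      h.skew_left, h.skew_right]
    module
  have hh : hodge2 M (a' • metricForm M k l + b' • volForm M k l + (c' * U k l + d' * V k l) • U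
      + (d' * U k l - c' * V k l) • V) = a' • volForm M k l - b' • metricForm M k l
        + (c' * U k l + d' * V k l) • V - (d' * U k l - c' * V k l) • U := by
    have h1 := h.hodge_metricForm k l
    have h2 := h.hodge_volForm k l
    have h3 := h.hodge_left
    have h4 := h.hodge_right
    simp only [hodge2] at *
    simp only [act4_add_right, act4_smul_right, h1, h2, h3, h4]
    module
  have h5 := typeD_column (M := M) (U := U) (V := V) (a * a' - b * b') (a * b' + b * a')
        (a * c' - b * d' + c * a' - d * b' - (c * c' - d * d'))
        (a * d' + b * c' + c * b' + d * a' - (c * d' + d * c')) k l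
  have h6 : ∀ P : Tensor4, P i j k l = (Matrix.of fun i j => P i j k l : Tensor2) i j :=
    fun P => rfl
  rw [h6 (typeD _ _ _ _ _ _ _), h5, h.act4_typeD a b c d hs, hh]
  simp only [pair2_add_right, pair2_smul_right, pair2_metricForm h.det_ne h.skew_left,
    pair2_metricForm h.det_ne h.skew_right, h.pair_volForm_left, h.pair_volForm_right,
    h.pair_left, h.pair_right, h.pair_mixed, h.pair_mixed_symm, Matrix.add_apply, Matrix.sub_apply,
    Matrix.smul_apply, smul_eq_mul]
  ring

theorem tr4_typeD (a b c d : ℝ) : tr4 M (typeD M U V a b c d) = 6 * a - 2 * c := by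
  simp only [typeD, tr4_add, tr4_smul, tr4_outer, tr4_metricG h.det_ne, tr4_volEl h.symm,
    h.pair_left, h.pair_right, h.pair_mixed, h.pair_mixed_symm]
  ring

theorem hodge4_typeD (a b c d : ℝ) :
    hodge4 M (typeD M U V a b c d) = typeD M U V (-b) a (-d) c := by
  have : volEl M = typeD M U V 0 1 0 0 := by simp [typeD]
  rw [hodge4, this, h.comp4_typeD]
  congr 1 <;> ring

/-- For `w = a + ib`, these are the real and imaginary parts of `6w²` and `-6w³`, up to sign: the
eigenvalues of `w (1 + 3P)` are `w, w, -2w`. -/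
theorem invariants_typeD (a b : ℝ) :
    invA M (typeD M U V a b (3 * a) (3 * b)) = 6 * (a ^ 2 - b ^ 2) ∧
    invB M (typeD M U V a b (3 * a) (3 * b)) = -12 * (a * b) ∧
    invD M (typeD M U V a b (3 * a) (3 * b)) = -6 * (a ^ 3 - 3 * a * b ^ 2) ∧
    invE M (typeD M U V a b (3 * a) (3 * b)) = 6 * (3 * a ^ 2 * b - b ^ 3) := by
  simp only [invA, invB, invD, invE, h.hodge4_typeD, h.comp4_typeD, h.tr4_typeD]
  refine ⟨?_, ?_, ?_, ?_⟩ <;> ring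

theorem eig_typeD {a b : ℝ} (hab : a ^ 2 + b ^ 2 ≠ 0) :
    eigRe M (typeD M U V a b (3 * a) (3 * b)) = a ∧
    eigIm M (typeD M U V a b (3 * a) (3 * b)) = b := by
  obtain ⟨hA, hB, hD, hE⟩ := h.invariants_typeD a b
  have h0 : (6 * (a ^ 2 - b ^ 2)) ^ 2 + (-12 * (a * b)) ^ 2 ≠ 0 := by
    have : (6 * (a ^ 2 - b ^ 2)) ^ 2 + (-12 * (a * b)) ^ 2 = 36 * (a ^ 2 + b ^ 2) ^ 2 := by ring
    rw [this]; positivity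
  simp only [eigRe, eigIm, hA, hB, hD, hE]
  constructor <;> rw [div_eq_iff h0] <;> ring

/-- Removing the double eigenvalue leaves `3wP`, of complex rank one. -/
theorem projP_typeD {a b : ℝ} (hab : a ^ 2 + b ^ 2 ≠ 0) :
    projP M (typeD M U V a b (3 * a) (3 * b)) = typeD M U V 0 0 (3 * a) (3 * b) := by
  obtain ⟨h1, h2⟩ := h.eig_typeD hab
  ext i j k l
  simp only [projP, h1, h2]
  simp [typeD]
  ring

omit h in
theorem tr2_dot2 (hM : M.transpose = M) {A B : Tensor2} (hB : B.transpose = -B) :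
    tr2 M (dot2 M A B) = -2 * pair2 M A B := by
  have hi : M⁻¹.transpose = M⁻¹ := by rw [Matrix.transpose_nonsing_inv, hM]
  have h1 : (M⁻¹ * B * M⁻¹).transpose = -(M⁻¹ * B * M⁻¹) := by
    simp [Matrix.transpose_mul, hi, hB, Matrix.mul_assoc]
  have h2 : tr2 M (dot2 M A B) = (A * (M⁻¹ * B * M⁻¹)).trace := by
    rw [tr2, dot2, Matrix.trace_mul_comm]
    simp only [Matrix.mul_assoc]
  rw [h2, pair2, hi, Matrix.trace]
  simp only [Matrix.diag_apply, Matrix.mul_apply (M := A)]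
  rw [← mul_assoc, show (-2 : ℝ) * (1 / 2) = -1 by norm_num, neg_one_mul, ← Finset.sum_neg_distrib]
  refine Finset.sum_congr rfl fun m _ => ?_
  rw [← Finset.sum_neg_distrib]
  refine Finset.sum_congr rfl fun n _ => ?_
  rw [show (M⁻¹ * B * M⁻¹) n m = -(M⁻¹ * B * M⁻¹) m n from congrFun (congrFun h1 m) n]
  ring

/-- The data of `F = xU + yV` that enter the canonical bivector: `tr F²`, `*F` and `tr (F · *F)`. -/
theorem hodge2_comb (x y : ℝ) :
    tr2 M (dot2 M (x • U + y • V) (x • U + y • V)) = 2 * (x ^ 2 - y ^ 2) ∧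
    hodge2 M (x • U + y • V) = x • V - y • U ∧
    tr2 M (dot2 M (x • U + y • V) (x • V - y • U)) = -4 * (x * y) := by
  have hs : ∀ x y : ℝ, (x • U + y • V).transpose = -(x • U + y • V) := fun x y => by
    simp only [Matrix.transpose_add, Matrix.transpose_smul, h.skew_left, h.skew_right]
    module
  have hsub : x • V - y • U = (-y) • U + x • V := by module
  refine ⟨?_, ?_, ?_⟩
  · rw [tr2_dot2 h.symm (hs x y)]
    simp only [pair2_add_right, pair2_smul_right, pair2_add_left, pair2_smul_left,
      h.pair_left, h.pair_right, h.pair_mixed, h.pair_mixed_symm]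
    ring
  · have h3 := h.hodge_left
    have h4 := h.hodge_right
    simp only [hodge2] at *
    simp only [act4_add_right, act4_smul_right, h3, h4]
    module
  · rw [hsub, tr2_dot2 h.symm (hs _ _)]
    simp only [pair2_add_right, pair2_smul_right, pair2_add_left, pair2_smul_left,
      h.pair_left, h.pair_right, h.pair_mixed, h.pair_mixed_symm]
    ring

/-- The projection of `Z` is `xU + yV`; the admissibility condition reads `x ≠ 0`, and the canonical
bivector is `U` with the sign of `x`, whatever `y` is. -/
theorem bivU_typeD {a b : ℝ} (hab : a ^ 2 + b ^ 2 ≠ 0) {Z : Tensor2} {x : ℝ}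
    (hx : x = 3 * (a * pair2 M U Z + b * pair2 M V Z)) :
    (denomU M (typeD M U V a b (3 * a) (3 * b)) Z ≠ 0 ↔ x ≠ 0) ∧
    (x ≠ 0 → bivU M (typeD M U V a b (3 * a) (3 * b)) Z = (SignType.sign x : ℝ) • U) := by
  set W := typeD M U V a b (3 * a) (3 * b) with hW
  set y : ℝ := 3 * (b * pair2 M U Z - a * pair2 M V Z) with hy
  have hF : bivF M W Z = x • U + y • V := by
    rw [bivF, hW, h.projP_typeD hab, hx, hy]
    simp only [typeD, act4_add, act4_smul, act4_outer]
    module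
  obtain ⟨h1, h2, h3⟩ := h.hodge2_comb x y
  have hf : scalF M W Z = 2 * (x ^ 2 - y ^ 2) := by rw [scalF, hF, h1]
  have hft : scalFt M W Z = -4 * (x * y) := by rw [scalFt, hF, h2, h3]
  have hchi : scalChi M W Z = 2 * (x ^ 2 + y ^ 2) := by
    rw [scalChi, hf, hft, show (2 * (x ^ 2 - y ^ 2)) ^ 2 + (-4 * (x * y)) ^ 2
      = (2 * (x ^ 2 + y ^ 2)) ^ 2 by ring, Real.sqrt_sq (by positivity)]
  have hden : denomU M W Z = 4 * (x ^ 2 + y ^ 2) * |x| := by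
    rw [denomU, hchi, hf, show 2 * (x ^ 2 + y ^ 2) + 2 * (x ^ 2 - y ^ 2) = (2 * x) ^ 2 by ring,
      Real.sqrt_sq_eq_abs, abs_mul, abs_two]
    ring
  constructor
  · rw [hden]
    constructor
    · rintro h0 rfl
      simp at h0
    · intro hx0
      positivity
  · intro hx0
    have hs : (SignType.sign x : ℝ) = x / |x| := by
      rw [eq_div_iff (abs_ne_zero.2 hx0)]
      exact sign_mul_abs x
    have hp : 0 < x ^ 2 + y ^ 2 := by positivity
    rw [bivU, hden, hchi, hf, hft, hF, h2, hs]
    have e1 : (2 * (x ^ 2 + y ^ 2) + 2 * (x ^ 2 - y ^ 2)) • (x • U + y • V)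
        + (-4 * (x * y)) • (x • V - y • U) = (4 * (x ^ 2 + y ^ 2) * x) • U := by
      module
    rw [e1, smul_smul]
    congr 1
    have := abs_ne_zero.2 hx0
    field_simp

end IsDualPair

/-! ### Frame components of the metric, the volume element and the curvature -/

/-- The contraction `ε_{αβγδ} Z^{γδ}` with the Levi-Civita symbol, as a linear map. -/
def dualMat : Tensor2 →ₗ[ℝ] Tensor2 where
  toFun Z :=
    !![0, Z 2 3 - Z 3 2, Z 3 1 - Z 1 3, Z 1 2 - Z 2 1;
       Z 3 2 - Z 2 3, 0, Z 0 3 - Z 3 0, Z 2 0 - Z 0 2;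
       Z 1 3 - Z 3 1, Z 3 0 - Z 0 3, 0, Z 0 1 - Z 1 0;
       Z 2 1 - Z 1 2, Z 0 2 - Z 2 0, Z 1 0 - Z 0 1, 0]
  map_add' X Y := by
    ext i j; fin_cases i <;> fin_cases j <;> simp <;> ring
  map_smul' t X := by
    ext i j; fin_cases i <;> fin_cases j <;> simp <;> ring

/-- Laplace expansion of a determinant along the first two rows. -/
theorem det_rows (w z x y : Pt) : (Matrix.of ![w, z, x, y]).det
    = ∑ α, ∑ β, w α * dualMat (Matrix.vecMulVec x y) α β * z β := by
  simp [dualMat, Matrix.vecMulVec, Matrix.det_succ_row_zero, Fin.sum_univ_succ, Fin.succAbove]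
  ring

theorem det_frameMetric : frameMetric.det = -1 := by
  simp [frameMetric, Matrix.det_succ_row_zero, Fin.sum_univ_succ, Fin.succAbove]

theorem frameMetric_transpose : frameMetric.transpose = frameMetric := by
  ext i j; fin_cases i <;> fin_cases j <;> rfl

theorem frameMetric_inv : frameMetric⁻¹ = frameMetric := by
  refine Matrix.inv_eq_left_inv ?_
  ext i j
  fin_cases i <;> fin_cases j <;> simp [frameMetric, Matrix.mul_apply, Fin.sum_univ_four]

theorem frameMetric_conj (X : Tensor2) : frameMetric * X * frameMetric =
    !![X 1 1, X 1 0, -X 1 2, -X 1 3; X 0 1, X 0 0, -X 0 2, -X 0 3;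
       -X 2 1, -X 2 0, X 2 2, X 2 3; -X 3 1, -X 3 0, X 3 2, X 3 3] := by
  ext i j
  simp only [Matrix.mul_apply, Fin.sum_univ_four]
  fin_cases i <;> fin_cases j <;> simp [frameMetric]

/-- The sign of the determinant of a coframe, `1` if it is positively oriented. -/
def orient (e : Tensor2) : ℝ := (SignType.sign e.det : ℝ)

/-- Coordinate components of the two-tensor with components `X` in the coframe `e`. -/
def pull2 (e X : Tensor2) : Tensor2 := e.transpose * X * e

theorem pull2_smul (e X : Tensor2) (t : ℝ) : pull2 e (t • X) = t • pull2 e X := by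
  simp [pull2]

theorem pull2_add (e X Y : Tensor2) : pull2 e (X + Y) = pull2 e X + pull2 e Y := by
  simp [pull2, Matrix.mul_add, Matrix.add_mul]

theorem pull2_sub (e X Y : Tensor2) : pull2 e (X - Y) = pull2 e X - pull2 e Y := by
  simp [pull2, Matrix.mul_sub, Matrix.sub_mul]

theorem pull2_sum (e : Tensor2) {ι : Type*} (s : Finset ι) (X : ι → Tensor2) :
    pull2 e (∑ k ∈ s, X k) = ∑ k ∈ s, pull2 e (X k) := by
  simp [pull2, Finset.mul_sum, Finset.sum_mul]

theorem dualMat_dualMat (Z : Tensor2) :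
    dualMat (frameMetric * dualMat Z * frameMetric)
      = (-2 : ℝ) • (frameMetric * (Z - Z.transpose) * frameMetric) := by
  rw [frameMetric_conj, frameMetric_conj]
  ext i j
  fin_cases i <;> fin_cases j <;> simp [dualMat] <;> ring

theorem pull2_conj_vecMulVec {M e : Tensor2} (hM : M = pull2 e frameMetric) (a b c d : Fin 4) :
    pull2 e (frameMetric * Matrix.vecMulVec (e.transpose c) (e.transpose d) * frameMetric) a b
      = M a c * M d b := by
  have h1 : pull2 e (frameMetric * Matrix.vecMulVec (e.transpose c) (e.transpose d) * frameMetric)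
      = (e.transpose * frameMetric) * Matrix.vecMulVec (e.transpose c) (e.transpose d)
        * (frameMetric * e) := by simp only [pull2, Matrix.mul_assoc]
  have h2 : (e.transpose * frameMetric * e) d b
      = Matrix.vecMul (e.transpose d) (frameMetric * e) b := by rw [Matrix.mul_assoc]; rfl
  rw [h1, Matrix.mul_vecMulVec, Matrix.vecMulVec_mul, Matrix.vecMulVec_apply, hM, pull2, h2]
  rfl

/-- The Levi-Civita symbol in the frame `e`. -/
theorem det_mul_epsilon (e : Tensor2) (a b c d : Fin 4) : e.det * epsilon a b c d
    = pull2 e (dualMat (Matrix.vecMulVec (e.transpose c) (e.transpose d))) a b := by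
  have h2 : (Matrix.of ![basisVec a, basisVec b, basisVec c, basisVec d]) * e.transpose
      = Matrix.of ![e.transpose a, e.transpose b, e.transpose c, e.transpose d] := by
    ext i j
    fin_cases i <;> simp [Matrix.mul_apply, basisVec, Pi.single_apply]
  rw [epsilon, mul_comm, ← Matrix.det_transpose e, ← Matrix.det_mul, h2, det_rows, pull2]
  rw [Matrix.mul_apply, Finset.sum_comm]
  refine Finset.sum_congr rfl fun β _ => ?_
  rw [Matrix.mul_apply, Finset.sum_mul]
  rfl

section Frame
variable {M e : Tensor2} (hM : M = pull2 e frameMetric) (he : e.det ≠ 0)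
include hM he

theorem frame_det_ne : M.det ≠ 0 := by
  rw [hM, pull2, Matrix.det_mul, Matrix.det_mul, Matrix.det_transpose, det_frameMetric]
  simpa using he

theorem frame_inv : e * M⁻¹ * e.transpose = frameMetric := by
  rw [hM, pull2, conj_inv _ he, frameMetric_inv]

theorem frame_raise (X : Tensor2) :
    e * (M⁻¹ * pull2 e X * M⁻¹.transpose) * e.transpose = frameMetric * X * frameMetric := by
  have h1 := frame_inv hM he
  have h2 : e * M⁻¹.transpose * e.transpose = frameMetric := by
    rw [← frameMetric_transpose, ← h1]
    simp only [Matrix.transpose_mul, Matrix.transpose_transpose, Matrix.mul_assoc]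
  calc _ = (e * M⁻¹ * e.transpose) * X * (e * M⁻¹.transpose * e.transpose) := by
        simp only [pull2, Matrix.mul_assoc]
    _ = _ := by rw [h1, h2]

omit he in
theorem volEl_frame (a b c d : Fin 4) : volEl M a b c d = orient e *
    pull2 e (dualMat (Matrix.vecMulVec (e.transpose c) (e.transpose d))) a b := by
  have h1 : M.det = -e.det ^ 2 := by
    rw [hM, pull2, Matrix.det_mul, Matrix.det_mul, Matrix.det_transpose, det_frameMetric]; ring
  rw [volEl, h1, abs_neg, abs_of_nonneg (sq_nonneg _), Real.sqrt_sq_eq_abs, ← det_mul_epsilon,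
    ← mul_assoc, orient, sign_mul_self]

omit hM in
theorem orient_mul_self : orient e * orient e = 1 := by
  unfold orient
  rcases lt_or_gt_of_ne he with h | h
  · simp [sign_neg h]
  · simp [sign_pos h]

theorem hodge2_frame (X : Tensor2) : hodge2 M (pull2 e X) = (orient e / 2) •
    pull2 e (dualMat (frameMetric * X * frameMetric)) := by
  rw [← frame_raise hM he]
  set Y := M⁻¹ * pull2 e X * M⁻¹.transpose with hY
  have h1 : e * Y * e.transpose
      = ∑ m, ∑ n, Y m n • Matrix.vecMulVec (e.transpose m) (e.transpose n) := by
    ext i j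
    simp only [Matrix.sum_apply, Matrix.smul_apply, Matrix.vecMulVec_apply, smul_eq_mul,
      Matrix.transpose_apply]
    rw [Matrix.mul_apply, Finset.sum_comm]
    refine Finset.sum_congr rfl fun n _ => ?_
    rw [Matrix.mul_apply, Finset.sum_mul]
    refine Finset.sum_congr rfl fun m _ => ?_
    rw [Matrix.transpose_apply]; ring
  ext a b
  rw [h1, hodge2, act4_apply]
  simp only [map_sum, map_smul, pull2_smul, pull2_sum, Finset.mul_sum,
    Matrix.smul_apply, Matrix.sum_apply, smul_eq_mul]
  refine Finset.sum_congr rfl fun m _ => Finset.sum_congr rfl fun n _ => ?_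
  rw [volEl_frame hM, ← hY]
  ring

theorem pair2_frame (A B : Tensor2) : pair2 M (pull2 e A) (pull2 e B)
    = (1 / 2) * (A.transpose * (frameMetric * B * frameMetric)).trace := by
  rw [← frame_raise hM he, pair2]
  set Y := M⁻¹ * pull2 e B * M⁻¹.transpose
  have h1 : ∑ m, ∑ n, pull2 e A m n * Y m n = ((pull2 e A).transpose * Y).trace := by
    rw [Finset.sum_comm, Matrix.trace]
    simp only [Matrix.diag_apply, Matrix.mul_apply (M := (pull2 e A).transpose),
      Matrix.transpose_apply]
  rw [h1, pull2]
  simp only [Matrix.transpose_mul, Matrix.transpose_transpose]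
  rw [Matrix.mul_assoc, Matrix.trace_mul_comm]
  simp only [Matrix.mul_assoc]

/-- In a null frame, `e⁰ ∧ e¹` and `∓e² ∧ e³` form a dual pair, the sign being the orientation. -/
theorem isDualPair_frame : IsDualPair M (pull2 e planeForm)
    (orient e • pull2 e planeDual) where
  symm := by
    rw [hM, pull2]
    simp only [Matrix.transpose_mul, Matrix.transpose_transpose, frameMetric_transpose,
      Matrix.mul_assoc]
  det_ne := frame_det_ne hM he
  skew_left := by
    have : planeForm.transpose = -planeForm := by
      ext i j; fin_cases i <;> fin_cases j <;> simp [planeForm]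
    simp [pull2, Matrix.transpose_mul, this, Matrix.mul_assoc]
  skew_right := by
    have : planeDual.transpose = -planeDual := by
      ext i j; fin_cases i <;> fin_cases j <;> simp [planeDual]
    simp [pull2, Matrix.transpose_mul, this, Matrix.mul_assoc]
  pair_left := by
    rw [pair2_frame hM he, frameMetric_conj]
    simp [Matrix.trace, Matrix.mul_apply, Fin.sum_univ_four, planeForm]
    norm_num
  pair_right := by
    rw [pair2_smul_left, pair2_smul_right, pair2_frame hM he, ← mul_assoc, orient_mul_self he,
      frameMetric_conj]
    simp [Matrix.trace, Matrix.mul_apply, Fin.sum_univ_four, planeDual]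
    norm_num
  pair_mixed := by
    rw [pair2_smul_right, pair2_frame hM he, frameMetric_conj]
    simp [Matrix.trace, Matrix.mul_apply, Fin.sum_univ_four, planeForm, planeDual]
  hodge_left := by
    have : dualMat (frameMetric * planeForm * frameMetric) = (2 : ℝ) • planeDual := by
      rw [frameMetric_conj]
      ext i j; fin_cases i <;> fin_cases j <;>
        simp [dualMat, planeForm, planeDual] <;> norm_num
    rw [hodge2_frame hM he, this]
    simp only [pull2, Matrix.mul_smul, Matrix.smul_mul, smul_smul]
    congr 1; ring
  hodge_right := by
    have : dualMat (frameMetric * planeDual * frameMetric) = (-2 : ℝ) • planeForm := by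
      rw [frameMetric_conj]
      ext i j; fin_cases i <;> fin_cases j <;>
        simp [dualMat, planeForm, planeDual] <;> norm_num
    rw [hodge2, act4_smul_right, ← hodge2, hodge2_frame hM he, this]
    simp only [pull2, Matrix.mul_smul, Matrix.smul_mul, smul_smul]
    rw [show orient e * (orient e / 2 * -2) = -1 by
      linear_combination -orient_mul_self he]
    simp
  hodge_volForm c d := by
    have h1 : volForm M c d = orient e •
        pull2 e (dualMat (Matrix.vecMulVec (e.transpose c) (e.transpose d))) := by
      ext a b
      simp only [volForm, Matrix.of_apply, volEl_frame hM, Matrix.smul_apply, smul_eq_mul]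
    have h2 : metricForm M c d = pull2 e (frameMetric *
        (Matrix.vecMulVec (e.transpose c) (e.transpose d)
          - (Matrix.vecMulVec (e.transpose c) (e.transpose d)).transpose) * frameMetric) := by
      have hs : M.transpose = M := by
        rw [hM, pull2]
        simp only [Matrix.transpose_mul, Matrix.transpose_transpose, frameMetric_transpose,
          Matrix.mul_assoc]
      have hs' : ∀ i j, M i j = M j i := fun i j => congrFun (congrFun hs j) i
      ext a b
      rw [Matrix.transpose_vecMulVec, Matrix.mul_sub, Matrix.sub_mul, pull2_sub, Matrix.sub_apply,
        pull2_conj_vecMulVec hM, pull2_conj_vecMulVec hM, hs' d b, hs' c b]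
      rfl
    rw [h1, hodge2, act4_smul_right, ← hodge2, hodge2_frame hM he, dualMat_dualMat, h2]
    simp only [pull2, Matrix.mul_smul, Matrix.smul_mul, smul_smul]
    rw [show orient e * (orient e / 2 * -2) = -1 by
      linear_combination -orient_mul_self he]
    simp
end Frame

/-- The lowered curvature form splits into a metric part, a volume part and products of `planeForm`
and `planeDual`. -/
theorem frameMetric_mul_typeDCurv (α β : ℝ) (x y : Pt) :
    frameMetric * typeDCurv α β (fun γ δ => x γ * y δ - x δ * y γ)
      = α • (frameMetric * (Matrix.vecMulVec x y - (Matrix.vecMulVec x y).transpose) * frameMetric)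
        + β • dualMat (Matrix.vecMulVec x y)
        + (3 * α * (x 0 * y 1 - x 1 * y 0) - 3 * β * (x 2 * y 3 - x 3 * y 2)) • planeForm
        + (3 * α * (x 2 * y 3 - x 3 * y 2) + 3 * β * (x 0 * y 1 - x 1 * y 0)) • planeDual := by
  rw [frameMetric_conj]
  ext i j
  fin_cases i <;> fin_cases j <;>
    simp [Matrix.mul_apply, Fin.sum_univ_four, frameMetric, typeDCurv, lorentz, dualMat, planeForm,
      planeDual, Matrix.vecMulVec_apply] <;> first | ring1 | (left; ring1) | (right; ring1)

theorem pull2_planeForm (e : Tensor2) (c d : Fin 4) :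
    pull2 e planeForm c d = e 0 c * e 1 d - e 1 c * e 0 d := by
  simp [pull2, planeForm, Matrix.mul_apply, Fin.sum_univ_four]; ring

theorem pull2_planeDual (e : Tensor2) (c d : Fin 4) :
    pull2 e planeDual c d = -(e 2 c * e 3 d - e 3 c * e 2 d) := by
  simp [pull2, planeDual, Matrix.mul_apply, Fin.sum_univ_four]; ring

/-- A type D curvature form is `w (G + 3P)` with `w = α ± iβ`, the sign being the orientation. -/
theorem pull2_typeDCurv {M e : Tensor2} (hM : M = pull2 e frameMetric) (he : e.det ≠ 0)
    (α β : ℝ) (a b c d : Fin 4) :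
    pull2 e (frameMetric * typeDCurv α β (fun γ δ => e γ c * e δ d - e δ c * e γ d)) a b
      = typeD M (pull2 e planeForm) (orient e • pull2 e planeDual)
          α (orient e * β) (3 * α) (3 * (orient e * β))
          a b c d := by
  have h := frameMetric_mul_typeDCurv α β (e.transpose c) (e.transpose d)
  simp only [Matrix.transpose_apply] at h
  have hs' : ∀ i j, M i j = M j i := fun i j =>
    congrFun (congrFun (isDualPair_frame hM he).symm j) i
  have ho := orient_mul_self he
  rw [h, Matrix.transpose_vecMulVec, Matrix.mul_sub, Matrix.sub_mul]
  simp only [typeD, Pi.add_apply, Pi.smul_apply, smul_eq_mul, outer, volEl_frame hM, metricG,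
    pull2_add, pull2_smul, pull2_sub, Matrix.add_apply, Matrix.sub_apply, Matrix.smul_apply,
    pull2_conj_vecMulVec hM, pull2_planeForm e c d, pull2_planeDual e c d]
  rw [hs' d b, hs' c b]
  generalize orient e = o at ho ⊢
  generalize pull2 e (dualMat _) a b = D
  generalize pull2 e planeForm a b = u
  generalize pull2 e planeDual a b = v
  linear_combination (β * D * (-1) + 3 * α * v * (-(e 2 c * e 3 d - e 3 c * e 2 d))
    - 3 * β * (u * (-(e 2 c * e 3 d - e 3 c * e 2 d)) + v * (e 0 c * e 1 d - e 1 c * e 0 d))) * ho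

/-- A double form `w (G + 3P)` is Ricci flat, because `U² - V² = g` and `U · V = 0` as
endomorphisms. -/
theorem ricci_typeD {M U V : Tensor2} (h : IsDualPair M U V)
    (h1 : dot2 M U U - dot2 M V V = M) (h2 : dot2 M U V = 0) (h3 : dot2 M V U = 0) (α β : ℝ)
    (b d : Fin 4) :
    ∑ a, ∑ k, M⁻¹ a k * typeD M U V α β (3 * α) (3 * β) k b a d = 0 := by
  have hi : M⁻¹.transpose = M⁻¹ := by rw [Matrix.transpose_nonsing_inv, h.symm]
  have hi' : ∀ i j, M⁻¹ i j = M⁻¹ j i := fun i j => congrFun (congrFun hi j) i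
  have hs' : ∀ i j, M i j = M j i := fun i j => congrFun (congrFun h.symm j) i
  have hdot : ∀ A B : Tensor2, A.transpose = -A →
      ∑ a, ∑ k, M⁻¹ a k * (A k b * B a d) = -dot2 M A B b d := by
    intro A B hA
    rw [dot2, Matrix.mul_apply, ← Finset.sum_neg_distrib]
    refine Finset.sum_congr rfl fun a _ => ?_
    rw [Matrix.mul_apply, Finset.sum_mul, ← Finset.sum_neg_distrib]
    refine Finset.sum_congr rfl fun k _ => ?_
    rw [show A k b = -A b k from congrFun (congrFun hA b) k, hi' a k]; ring
  have hvol : ∑ a, ∑ k, M⁻¹ a k * volEl M k b a d = 0 := by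
    have : ∑ a, ∑ k, M⁻¹ a k * volEl M k b a d = -∑ a, ∑ k, M⁻¹ a k * volEl M k b a d := by
      conv_lhs => rw [Finset.sum_comm]
      simp only [← Finset.sum_neg_distrib]
      refine Finset.sum_congr rfl fun k _ => Finset.sum_congr rfl fun a _ => ?_
      rw [volEl_swap_mid, hi']; ring
    linarith
  have hδ : ∀ a b, ∑ k, M⁻¹ a k * M k b = if a = b then 1 else 0 := fun a b => by
    rw [← Matrix.mul_apply, Matrix.nonsing_inv_mul _ h.det_ne.isUnit, Matrix.one_apply]
  have hG : ∑ a, ∑ k, M⁻¹ a k * metricG M k b a d = 3 * M b d := by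
    have e1 : ∀ a, ∑ k, M⁻¹ a k * metricG M k b a d
        = (∑ k, M⁻¹ a k * M k a) * M b d - (∑ k, M⁻¹ a k * M k d) * M b a := fun a => by
      simp only [metricG, Finset.sum_mul, ← Finset.sum_sub_distrib]
      exact Finset.sum_congr rfl fun k _ => by ring
    simp only [e1, hδ]
    simp
    ring
  have hlin : ∀ a k, M⁻¹ a k * typeD M U V α β (3 * α) (3 * β) k b a d
      = α * (M⁻¹ a k * metricG M k b a d) + β * (M⁻¹ a k * volEl M k b a d)
        + 3 * α * (M⁻¹ a k * (U k b * U a d)) - 3 * α * (M⁻¹ a k * (V k b * V a d))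
        + 3 * β * (M⁻¹ a k * (U k b * V a d)) + 3 * β * (M⁻¹ a k * (V k b * U a d)) := by
    intro a k
    simp only [typeD, Pi.add_apply, Pi.smul_apply, smul_eq_mul, outer]
    ring
  simp only [hlin, Finset.sum_add_distrib, Finset.sum_sub_distrib, ← Finset.mul_sum, hG, hvol,
    hdot _ _ h.skew_left, hdot _ _ h.skew_right, h2, h3]
  have h1' := congrFun (congrFun h1 b) d
  rw [Matrix.sub_apply] at h1'
  simp only [Matrix.zero_apply]
  linear_combination -3 * α * h1'

theorem dot2_frame {M e : Tensor2} (h : e * M⁻¹ * e.transpose = frameMetric) (A B : Tensor2) :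
    dot2 M (pull2 e A) (pull2 e B) = pull2 e (A * frameMetric * B) := by
  rw [← h]
  simp only [dot2, pull2, Matrix.mul_assoc]

theorem planeForm_sq_sub : planeForm * frameMetric * planeForm - planeDual * frameMetric * planeDual
    = frameMetric := by
  ext i j
  fin_cases i <;> fin_cases j <;>
    simp [planeForm, planeDual, frameMetric, Matrix.mul_apply, Fin.sum_univ_four]

theorem planeForm_mul_planeDual : planeForm * frameMetric * planeDual = 0 := by
  ext i j
  fin_cases i <;> fin_cases j <;>
    simp [planeForm, planeDual, frameMetric, Matrix.mul_apply, Fin.sum_univ_four]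

theorem planeDual_mul_planeForm : planeDual * frameMetric * planeForm = 0 := by
  ext i j
  fin_cases i <;> fin_cases j <;>
    simp [planeForm, planeDual, frameMetric, Matrix.mul_apply, Fin.sum_univ_four]

/-! ### Curvature of a metric isometric to Kerr -/

/-- The pullback of the Kerr coframe to the coordinate patch. -/
def patchFrame (m a : ℝ) (Φ : Pt → Pt) (q : Pt) : Tensor2 := kerrFrame m a (Φ q) * jacobian Φ q

section
variable {m a : ℝ} {g : Pt → Tensor2} {Ω : Set Pt} {Φ : Pt → Pt} (hg : IsKerrOn m a g Ω Φ)
include hg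

theorem IsKerrOn.contDiffAt {p : Pt} (hp : p ∈ Ω) : ContDiffAt ℝ 3 Φ p :=
  contDiffAt_infty.1 (hg.smooth.contDiffAt (hg.isOpen.mem_nhds hp)) 3

theorem IsKerrOn.movingFrame :
    MovingFrame frameMetric g Ω (patchFrame m a Φ) (pullConn (kerrConn m a) Φ) where
  isOpen := hg.isOpen
  symm := frameMetric_transpose
  det_metric := by rw [det_frameMetric]; norm_num
  metric q hq := by
    rw [hg.pullback q hq, kerrMetric_eq (hg.mapsTo hq).1 (hg.mapsTo hq).2.1, patchFrame]
    simp only [Matrix.transpose_mul, Matrix.mul_assoc]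
  det_ne q hq := by
    rw [patchFrame, Matrix.det_mul]
    exact mul_ne_zero (det_kerrFrame_ne (hg.mapsTo hq)) (hg.det_ne_zero q hq)
  smooth q hq α i := by
    have hΦ := hg.contDiffAt hq
    simp only [patchFrame, Matrix.mul_apply]
    refine ContDiffAt.sum fun k _ => ContDiffAt.mul ?_ ?_
    · exact (contDiffAt_kerrFrame (hg.mapsTo hq) α k).comp q (hΦ.of_le (by norm_num))
    · exact contDiffAt_pderiv (contDiffAt_pi.1 hΦ k) i
  smooth_conn q hq i :=
    mdiffAt_pullConn (fun k => mdiffAt_kerrConn (hg.mapsTo hq) k) (hg.contDiffAt hq) i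
  torsion q hq α i j :=
    pull_torsion
      (fun α i => (contDiffAt_kerrFrame (hg.mapsTo hq) α i).differentiableAt (by norm_num))
      (hg.contDiffAt hq) (kerr_torsion (hg.mapsTo hq)) α i j
  skew q hq i := by
    simp only [pullConn, Matrix.transpose_sum, Finset.sum_mul, Finset.mul_sum,
      ← Finset.sum_add_distrib]
    refine Finset.sum_eq_zero fun k _ => ?_
    rw [Matrix.transpose_smul, Matrix.smul_mul, Matrix.mul_smul, ← smul_add, kerrConn, lorentz_skew,
      smul_zero]

end

section
variable {m a : ℝ} {g : Pt → Tensor2} {Ω : Set Pt} {Φ : Pt → Pt} (hg : IsKerrOn m a g Ω Φ)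
  {p : Pt} (hp : p ∈ Ω)
include hg hp

theorem IsKerrOn.metric_eq : g p = pull2 (patchFrame m a Φ p) frameMetric :=
  hg.movingFrame.metric p hp

/-- The Riemann tensor is `w (G + 3P)`, with `w = α ± iβ` the Kerr value. -/
theorem IsKerrOn.riemann_eq (b c d k : Fin 4) : riemann g p k b c d
    = typeD (g p) (pull2 (patchFrame m a Φ p) planeForm)
        (orient (patchFrame m a Φ p) • pull2 (patchFrame m a Φ p) planeDual)
        (kerrRe m a (Φ p)) (orient (patchFrame m a Φ p) * kerrIm m a (Φ p))
        (3 * kerrRe m a (Φ p)) (3 * (orient (patchFrame m a Φ p) * kerrIm m a (Φ p))) k b c d := by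
  have hf := hg.movingFrame
  have hM := hg.metric_eq hp
  have he := hf.det_ne p hp
  have hcurv := hf.riemannUp_eq hp c d
  rw [pull_curvature (fun k => mdiffAt_kerrConn (hg.mapsTo hp) k) (hg.contDiffAt hp)] at hcurv
  -- `typeDCurv` is linear in the bivector, so the Jacobians can be moved onto the coframe.
  have h1 : ∑ k, ∑ l, (jacobian Φ p k c * jacobian Φ p l d) •
        (mpderiv k (kerrConn m a l) (Φ p) - mpderiv l (kerrConn m a k) (Φ p)
          + (kerrConn m a k (Φ p) * kerrConn m a l (Φ p)
            - kerrConn m a l (Φ p) * kerrConn m a k (Φ p)))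
      = typeDCurv (kerrRe m a (Φ p)) (kerrIm m a (Φ p)) (fun γ δ =>
          patchFrame m a Φ p γ c * patchFrame m a Φ p δ d
            - patchFrame m a Φ p δ c * patchFrame m a Φ p γ d) := by
    have h2 : ∀ γ δ, patchFrame m a Φ p γ c * patchFrame m a Φ p δ d
            - patchFrame m a Φ p δ c * patchFrame m a Φ p γ d
        = ∑ k, ∑ l, (jacobian Φ p k c * jacobian Φ p l d) *
          (kerrFrame m a (Φ p) γ k * kerrFrame m a (Φ p) δ l
            - kerrFrame m a (Φ p) δ k * kerrFrame m a (Φ p) γ l) := by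
      intro γ δ
      simp only [patchFrame, Matrix.mul_apply, Finset.sum_mul_sum, ← Finset.sum_sub_distrib]
      exact Finset.sum_congr rfl fun k _ => Finset.sum_congr rfl fun l _ => by ring
    have h3 : ∀ (α β : ℝ) (t : Fin 4 → Fin 4 → ℝ) (B : Fin 4 → Fin 4 → Fin 4 → Fin 4 → ℝ),
        ∑ k, ∑ l, t k l • typeDCurv α β (B k l)
          = typeDCurv α β (fun γ δ => ∑ k, ∑ l, t k l * B k l γ δ) := by
      intro α β t B
      have e1 : ∀ X Y, typeDCurv α β X + typeDCurv α β Y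
          = typeDCurv α β (fun γ δ => X γ δ + Y γ δ) := fun X Y => by
        rw [typeDCurv, typeDCurv, lorentz_add, typeDCurv]
        congr 1 <;> ring
      have e2 : ∀ (r : ℝ) X, r • typeDCurv α β X = typeDCurv α β (fun γ δ => r * X γ δ) := by
        intro r X
        ext i j
        fin_cases i <;> fin_cases j <;> simp [typeDCurv, lorentz] <;> ring
      simp only [Fin.sum_univ_four, e1, e2]
    simp only [kerr_curvature (hg.mapsTo hp), h2, h3]
  rw [h1] at hcurv
  have h4 : (Matrix.of fun k b => riemann g p k b c d : Tensor2)
      = pull2 (patchFrame m a Φ p) (frameMetric * typeDCurv (kerrRe m a (Φ p)) (kerrIm m a (Φ p))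
        (fun γ δ => patchFrame m a Φ p γ c * patchFrame m a Φ p δ d
            - patchFrame m a Φ p δ c * patchFrame m a Φ p γ d)) := by
    have h5 : (Matrix.of fun k b => riemann g p k b c d : Tensor2)
        = g p * Matrix.of fun a b => riemannUp g a b c d p := by
      ext k b
      rw [Matrix.mul_apply]; rfl
    rw [h5, hM, pull2, pull2, Matrix.mul_assoc, hcurv]
    simp only [Matrix.mul_assoc]
  rw [← pull2_typeDCurv hM he, ← h4]
  rfl

theorem IsKerrOn.isDualPair : IsDualPair (g p) (pull2 (patchFrame m a Φ p) planeForm)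
        (orient (patchFrame m a Φ p) • pull2 (patchFrame m a Φ p) planeDual) :=
  isDualPair_frame (hg.metric_eq hp) (hg.movingFrame.det_ne p hp)

theorem IsKerrOn.ricci_eq : ricci g p = 0 := by
  ext b d
  have hM := hg.metric_eq hp
  have he := hg.movingFrame.det_ne p hp
  have hi := frame_inv hM he
  have hd := hg.isDualPair hp
  have h1 : ∀ i c, riemannUp g i b c d p = ∑ k, (g p)⁻¹ i k * riemann g p k b c d := by
    intro i c
    have : (∑ k, (g p)⁻¹ i k * riemann g p k b c d)
        = ((g p)⁻¹ * (g p * Matrix.of fun i b => riemannUp g i b c d p)) i b := by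
      rw [Matrix.mul_apply]
      refine Finset.sum_congr rfl fun k _ => ?_
      rw [Matrix.mul_apply]; rfl
    rw [this, ← Matrix.mul_assoc, Matrix.nonsing_inv_mul _ hd.det_ne.isUnit, Matrix.one_mul]
    rfl
  simp only [ricci, h1, hg.riemann_eq hp]
  have ho : orient (patchFrame m a Φ p) * orient (patchFrame m a Φ p) = 1 := orient_mul_self he
  have hs : ∀ (t : ℝ) (A B : Tensor2), dot2 (g p) A (t • B) = t • dot2 (g p) A B := fun t A B => by
    simp [dot2]
  have hs' : ∀ (t : ℝ) (A B : Tensor2), dot2 (g p) (t • A) B = t • dot2 (g p) A B := fun t A B => by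
    simp [dot2]
  refine ricci_typeD hd ?_ ?_ ?_ _ _ b d
  · rw [hs, hs', smul_smul, ho, one_smul, dot2_frame hi, dot2_frame hi, ← pull2_sub,
      planeForm_sq_sub, hM]
  · rw [hs, dot2_frame hi, planeForm_mul_planeDual]; simp [pull2]
  · rw [hs', dot2_frame hi, planeDual_mul_planeForm]; simp [pull2]

theorem IsKerrOn.weyl_eq : weyl g p
    = typeD (g p) (pull2 (patchFrame m a Φ p) planeForm)
        (orient (patchFrame m a Φ p) • pull2 (patchFrame m a Φ p) planeDual)
        (kerrRe m a (Φ p)) (orient (patchFrame m a Φ p) * kerrIm m a (Φ p))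
        (3 * kerrRe m a (Φ p)) (3 * (orient (patchFrame m a Φ p) * kerrIm m a (Φ p))) := by
  have h1 := hg.ricci_eq hp
  ext k b c d
  simp [weyl, scalarCurv, tr2, h1, hg.riemann_eq hp]

theorem IsKerrOn.frame_inv : patchFrame m a Φ p * (g p)⁻¹ * (patchFrame m a Φ p).transpose
    = frameMetric := KerrWeyl.frame_inv (hg.metric_eq hp) (hg.movingFrame.det_ne p hp)

/-- The vectors metrically equivalent to the coframe are mapped by `Φ` to those of the Kerr
coframe. -/
theorem IsKerrOn.jacobian_mul_inv : jacobian Φ p * (g p)⁻¹ * (patchFrame m a Φ p).transpose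
    = kerrDual m a (Φ p) * frameMetric := by
  have hD : kerrDual m a (Φ p) * kerrFrame m a (Φ p) = 1 :=
    mul_eq_one_comm.1 (kerrFrame_mul_dual (hg.mapsTo hp).1 (hg.mapsTo hp).2.1 (hg.mapsTo hp).2.2)
  rw [← hg.frame_inv hp]
  have : patchFrame m a Φ p = kerrFrame m a (Φ p) * jacobian Φ p := rfl
  conv_rhs => rw [this, ← Matrix.mul_assoc, ← Matrix.mul_assoc, ← Matrix.mul_assoc, hD,
    Matrix.one_mul, ← this]

/-- The codifferential of a two-form with constant frame components. -/
theorem IsKerrOn.codiff_eq {F : Pt → Tensor2} {F₀ : Tensor2}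
    (hF : ∀ᶠ q in 𝓝 p, F q = pull2 (patchFrame m a Φ q) F₀) (b : Fin 4) :
    codiff g F p b = ∑ β, patchFrame m a Φ p β b *
      ∑ k, ∑ α, (kerrDual m a (Φ p) * frameMetric) k α *
        ((kerrConn m a k (Φ p)).transpose * F₀ + F₀ * kerrConn m a k (Φ p)) α β := by
  have hf := hg.movingFrame
  have hd := hg.isDualPair hp
  have hsymm : ∀ i j, (g p)⁻¹ i j = (g p)⁻¹ j i := fun i j => by
    have : (g p)⁻¹.transpose = (g p)⁻¹ := by rw [Matrix.transpose_nonsing_inv, hd.symm]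
    exact congrFun (congrFun this j) i
  set e := patchFrame m a Φ p with he_def
  set J := jacobian Φ p with hJ
  set T : Fin 4 → Tensor2 := fun k =>
    (kerrConn m a k (Φ p)).transpose * F₀ + F₀ * kerrConn m a k (Φ p) with hT
  have h1 : ∀ c a' b, covDeriv2 g F c a' b p
      = -∑ k, J k c * (e.transpose * T k * e) a' b := by
    intro c a' b
    rw [hf.covDeriv2_eq hp hF]
    have : (pullConn (kerrConn m a) Φ c p).transpose * F₀ + F₀ * pullConn (kerrConn m a) Φ c p
        = ∑ k, J k c • T k := by
      simp only [pullConn, Matrix.transpose_sum, Finset.sum_mul, Finset.mul_sum,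
        ← Finset.sum_add_distrib, Matrix.transpose_smul, Matrix.smul_mul, Matrix.mul_smul,
        ← smul_add, hT, hJ]
    rw [this]
    simp only [Finset.mul_sum, Finset.sum_mul, Matrix.mul_smul, Matrix.smul_mul, Matrix.sum_apply,
      Matrix.smul_apply, smul_eq_mul, ← he_def]
  have h2 : J * (g p)⁻¹ * e.transpose = kerrDual m a (Φ p) * frameMetric :=
    hg.jacobian_mul_inv hp
  have h3 : ∀ k, ∑ a', ∑ c, (g p)⁻¹ a' c * (J k c * (e.transpose * T k * e) a' b)
      = ∑ β, e β b * ∑ α, (J * (g p)⁻¹ * e.transpose) k α * T k α β := by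
    intro k
    have e1 : ∑ a', ∑ c, (g p)⁻¹ a' c * (J k c * (e.transpose * T k * e) a' b)
        = ((J * (g p)⁻¹) * (e.transpose * T k * e)) k b := by
      rw [Matrix.mul_apply]
      refine Finset.sum_congr rfl fun a' _ => ?_
      have e2 : (J * (g p)⁻¹) k a' = ∑ c, J k c * (g p)⁻¹ c a' := Matrix.mul_apply
      rw [e2, Finset.sum_mul]
      refine Finset.sum_congr rfl fun c _ => ?_
      rw [hsymm a' c]; ring
    rw [e1, ← Matrix.mul_assoc, ← Matrix.mul_assoc, Matrix.mul_apply]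
    refine Finset.sum_congr rfl fun β _ => ?_
    rw [Matrix.mul_apply, mul_comm]
  simp only [codiff, h1]
  rw [← Finset.sum_neg_distrib]
  have h4 : ∑ a', -∑ c, (g p)⁻¹ a' c * -∑ k, J k c * (e.transpose * T k * e) a' b
      = ∑ k, ∑ a', ∑ c, (g p)⁻¹ a' c * (J k c * (e.transpose * T k * e) a' b) := by
    rw [Finset.sum_comm]
    refine Finset.sum_congr rfl fun a' _ => ?_
    rw [Finset.sum_comm, ← Finset.sum_neg_distrib]
    refine Finset.sum_congr rfl fun c _ => ?_
    rw [mul_neg, neg_neg, Finset.mul_sum]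
  rw [h4]
  simp only [h3, h2]
  rw [Finset.sum_comm]
  exact Finset.sum_congr rfl fun β _ => (Finset.mul_sum _ _ _).symm

end

/-! ### The canonical bivector and its codifferential -/

open Filter

theorem inner1_eq (M : Tensor2) (u v : Pt) : inner1 M u v = u ⬝ᵥ M⁻¹.mulVec v := by
  simp only [inner1, dotProduct, Matrix.mulVec, Finset.mul_sum]
  exact Finset.sum_congr rfl fun i _ => Finset.sum_congr rfl fun j _ => by ring

theorem inner1_smul (M : Tensor2) (s t : ℝ) (u v : Pt) :
    inner1 M (s • u) (t • v) = s * t * inner1 M u v := by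
  simp only [inner1_eq, Matrix.mulVec_smul, smul_dotProduct, dotProduct_smul, smul_eq_mul]
  ring

theorem sharp_eq (M : Tensor2) (u : Pt) : sharp M u = M⁻¹.mulVec u := rfl

theorem sharp_smul (M : Tensor2) (t : ℝ) (u : Pt) : sharp M (t • u) = t • sharp M u := by
  simp only [sharp_eq, Matrix.mulVec_smul]

/-- The pullback under `Φ` of the one-form metrically equivalent to `∂_t`. -/
def timeForm (m a : ℝ) (Φ : Pt → Pt) (q : Pt) : Pt :=
  (patchFrame m a Φ q).transpose.mulVec (kerrTime m a (Φ q))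

theorem eventually_sign_eq {f : Pt → ℝ} {p : Pt} (hf : ContinuousAt f p) (h0 : f p ≠ 0) :
    ∀ᶠ q in 𝓝 p, SignType.sign (f q) = SignType.sign (f p) := by
  rcases lt_or_gt_of_ne h0 with h | h
  · filter_upwards [hf.eventually_lt continuousAt_const h] with q hq
    rw [sign_neg h, sign_neg hq]
  · filter_upwards [continuousAt_const.eventually_lt hf h] with q hq
    rw [sign_pos h, sign_pos hq]

theorem differentiableAt_pair2 {M A B : Pt → Tensor2} {p : Pt} (hM : MDiffAt M p)
    (hdet : (M p).det ≠ 0) (hA : MDiffAt A p) (hB : MDiffAt B p) :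
    DifferentiableAt ℝ (fun q => pair2 (M q) (A q) (B q)) p := by
  have hi := hM.inv hdet
  simp only [pair2]
  exact (DifferentiableAt.fun_sum fun i _ => DifferentiableAt.fun_sum fun j _ =>
    (hA i j).fun_mul (((hi.mul hB).mul hi.transpose) i j)).const_mul _

theorem kerrSigma_pos {m a : ℝ} {x : Pt} (hx : x ∈ kerrDomain m a) : 0 < kerrSigma a x :=
  lt_of_le_of_ne (by unfold kerrSigma; positivity) (Ne.symm hx.1)

theorem kerrU_sq_add {m a : ℝ} {x : Pt} (hx : x ∈ kerrDomain m a) :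
    kerrU a x ^ 2 + kerrV a x ^ 2 = (kerrSigma a x)⁻¹ := by
  have h := (kerrSigma_pos hx).ne'
  have hS : x 1 ^ 2 + a ^ 2 * Real.cos (x 2) ^ 2 = kerrSigma a x := rfl
  rw [kerrU, kerrV, div_pow, div_pow, mul_pow, ← add_div, hS]
  field_simp

section
variable {m a : ℝ} {g : Pt → Tensor2} {Ω : Set Pt} {Φ : Pt → Pt} (hg : IsKerrOn m a g Ω Φ)
  {p : Pt} (hp : p ∈ Ω)
include hg hp

/-- `(∂_t)² = -(1 - 2mr/Σ)`. -/
theorem IsKerrOn.inner1_timeForm : inner1 (g p) (timeForm m a Φ p) (timeForm m a Φ p)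
    = (2 * m * Φ p 1 - kerrSigma a (Φ p)) / kerrSigma a (Φ p) := by
  have h1 : inner1 (g p) (timeForm m a Φ p) (timeForm m a Φ p)
      = kerrTime m a (Φ p) ⬝ᵥ frameMetric.mulVec (kerrTime m a (Φ p)) := by
    rw [inner1_eq, timeForm, ← hg.frame_inv hp, Matrix.mulVec_transpose, ← Matrix.dotProduct_mulVec]
    simp only [← Matrix.mulVec_transpose, Matrix.mulVec_mulVec, Matrix.mul_assoc]
  have h2 := kerrU_sq_add (hg.mapsTo hp)
  have h3 := (kerrSigma_pos (hg.mapsTo hp)).ne'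
  have hs := Real.sin_sq_add_cos_sq (Φ p 2)
  have h4 : kerrTime m a (Φ p) ⬝ᵥ frameMetric.mulVec (kerrTime m a (Φ p))
      = (a ^ 2 * Real.sin (Φ p 2) ^ 2 - kerrDelta m a (Φ p))
        * (kerrU a (Φ p) ^ 2 + kerrV a (Φ p) ^ 2) := by
    simp [dotProduct, Matrix.mulVec, Fin.sum_univ_four, kerrTime, frameMetric]
    ring
  rw [h1, h4, h2, ← div_eq_mul_inv]
  congr 1
  rw [kerrDelta, kerrSigma]
  linear_combination a ^ 2 * hs

theorem IsKerrOn.jacobian_sharp_timeForm :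
    (jacobian Φ p).mulVec (sharp (g p) (timeForm m a Φ p)) = basisVec 0 := by
  have hD : kerrDual m a (Φ p) * kerrFrame m a (Φ p) = 1 :=
    mul_eq_one_comm.1 (kerrFrame_mul_dual (hg.mapsTo hp).1 (hg.mapsTo hp).2.1 (hg.mapsTo hp).2.2)
  have hN : frameMetric * frameMetric = 1 := by
    conv_lhs => enter [1]; rw [← frameMetric_inv]
    exact Matrix.nonsing_inv_mul _ (by rw [det_frameMetric]; norm_num)
  have h1 : kerrTime m a (Φ p) = (frameMetric * kerrFrame m a (Φ p)).mulVec (basisVec 0) := by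
    ext α
    rw [kerrTime_eq]
    simp [basisVec]
  rw [sharp_eq, timeForm, Matrix.mulVec_mulVec, Matrix.mulVec_mulVec,
    hg.jacobian_mul_inv hp, h1, Matrix.mulVec_mulVec, Matrix.mul_assoc,
    ← Matrix.mul_assoc frameMetric, hN, Matrix.one_mul, hD, Matrix.one_mulVec]

/-- The part of `∂_t` tangent to the space-like principal plane has square `a² sin² θ / Σ`. -/
theorem IsKerrOn.projH_timeForm {s : ℝ} (hs : s * s = 1) :
    ∑ i, ∑ j, projH (g p) (s • pull2 (patchFrame m a Φ p) planeForm) i j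
      * sharp (g p) (timeForm m a Φ p) i * sharp (g p) (timeForm m a Φ p) j
      = a ^ 2 * Real.sin (Φ p 2) ^ 2 / kerrSigma a (Φ p) := by
  set e := patchFrame m a Φ p with he
  set v := sharp (g p) (timeForm m a Φ p) with hv
  have h1 : projH (g p) (s • pull2 e planeForm)
      = pull2 e (frameMetric - planeForm * frameMetric * planeForm) := by
    have : dot2 (g p) (s • pull2 e planeForm) (s • pull2 e planeForm)
        = (s * s) • dot2 (g p) (pull2 e planeForm) (pull2 e planeForm) := by
      simp [dot2, smul_smul]
    rw [projH, this, hs, one_smul, dot2_frame (hg.frame_inv hp), pull2_sub, ← hg.metric_eq hp]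
  have h2 : e.mulVec v = frameMetric.mulVec (kerrTime m a (Φ p)) := by
    rw [hv, sharp_eq, timeForm, Matrix.mulVec_mulVec, Matrix.mulVec_mulVec,
      hg.frame_inv hp]
  have h3 : ∀ Q : Tensor2, ∑ i, ∑ j, pull2 e Q i j * v i * v j
      = e.mulVec v ⬝ᵥ Q.mulVec (e.mulVec v) := by
    intro Q
    have e1 : ∑ i, ∑ j, pull2 e Q i j * v i * v j = v ⬝ᵥ (pull2 e Q).mulVec v := by
      simp only [dotProduct, Matrix.mulVec, Finset.mul_sum]
      exact Finset.sum_congr rfl fun i _ => Finset.sum_congr rfl fun j _ => by ring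
    rw [e1, pull2, ← Matrix.mulVec_mulVec, ← Matrix.mulVec_mulVec, Matrix.dotProduct_mulVec,
      Matrix.vecMul_transpose]
  rw [h1, h3, h2, div_eq_mul_inv, ← kerrU_sq_add (hg.mapsTo hp)]
  simp [dotProduct, Matrix.mulVec, Fin.sum_univ_four, kerrTime, frameMetric, planeForm]
  ring

/-- Transfer of a codifferential from the frame to the patch. -/
theorem IsKerrOn.codiff_smul {F : Pt → Tensor2} {F₀ : Tensor2} {t w : ℝ}
    (hF : ∀ᶠ q in 𝓝 p, F q = t • pull2 (patchFrame m a Φ q) F₀)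
    (hw : ∀ β, ∑ k, ∑ α, (kerrDual m a (Φ p) * frameMetric) k α *
        ((kerrConn m a k (Φ p)).transpose * F₀ + F₀ * kerrConn m a k (Φ p)) α β
          = -2 * w * kerrTime m a (Φ p) β) :
    codiff g F p = (-2 * t * w) • timeForm m a Φ p := by
  have hF' : ∀ᶠ q in 𝓝 p, F q = pull2 (patchFrame m a Φ q) (t • F₀) :=
    hF.mono fun q hq => by rw [hq, pull2_smul]
  ext b
  have h1 : ∀ k α β, ((kerrConn m a k (Φ p)).transpose * (t • F₀)
      + (t • F₀) * kerrConn m a k (Φ p)) α β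
      = t * ((kerrConn m a k (Φ p)).transpose * F₀ + F₀ * kerrConn m a k (Φ p)) α β := by
    intro k α β
    rw [Matrix.mul_smul, Matrix.smul_mul, ← smul_add, Matrix.smul_apply, smul_eq_mul]
  rw [hg.codiff_eq hp hF']
  simp only [h1, mul_left_comm _ t, ← Finset.mul_sum, hw]
  simp only [Pi.smul_apply, smul_eq_mul, timeForm, Matrix.mulVec, dotProduct,
    Matrix.transpose_apply, Finset.mul_sum]
  exact Finset.sum_congr rfl fun β _ => by ring

theorem IsKerrOn.codiff_plane {F : Pt → Tensor2} {t : ℝ}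
    (hF : ∀ᶠ q in 𝓝 p, F q = t • pull2 (patchFrame m a Φ q) planeForm) :
    codiff g F p = (-2 * t * kerrU a (Φ p)) • timeForm m a Φ p :=
  hg.codiff_smul hp hF fun β =>
    (kerr_codiff (hg.mapsTo hp).1 (hg.mapsTo hp).2.1 (hg.mapsTo hp).2.2 β).1

theorem IsKerrOn.codiff_planeDual {F : Pt → Tensor2} {t : ℝ}
    (hF : ∀ᶠ q in 𝓝 p, F q = t • pull2 (patchFrame m a Φ q) planeDual) :
    codiff g F p = (-2 * t * kerrV a (Φ p)) • timeForm m a Φ p :=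
  hg.codiff_smul hp hF fun β =>
    (kerr_codiff (hg.mapsTo hp).1 (hg.mapsTo hp).2.1 (hg.mapsTo hp).2.2 β).2

theorem IsKerrOn.eventually_orient :
    ∀ᶠ q in 𝓝 p, orient (patchFrame m a Φ q) = orient (patchFrame m a Φ p) := by
  filter_upwards [eventually_sign_eq ((hg.movingFrame.mdiff hp).det).continuousAt
    (hg.movingFrame.det_ne p hp)] with q hq
  rw [orient, orient, hq]

theorem IsKerrOn.weyl_ne : kerrRe m a (Φ p) ^ 2
    + (orient (patchFrame m a Φ p) * kerrIm m a (Φ p)) ^ 2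
      = m ^ 2 * (kerrSigma a (Φ p))⁻¹ ^ 3 := by
  have ho := orient_mul_self (hg.movingFrame.det_ne p hp)
  rw [← kerrU_sq_add (hg.mapsTo hp), kerrRe, kerrIm]
  linear_combination (m * (3 * kerrU a (Φ p) ^ 2 * kerrV a (Φ p) - kerrV a (Φ p) ^ 3)) ^ 2 * ho

/-- Near an admissible point the canonical bivector is `±e⁰ ∧ e¹`. The sign is that of a continuous
function which does not vanish at `p`, hence locally constant. -/
theorem IsKerrOn.canU_eventually (hm : m ≠ 0) {Z : Pt → Tensor2} (hZ : MDiffAt Z p)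
    (hU : Admissible g Z p) : ∃ s : ℝ, (s = 1 ∨ s = -1) ∧ ∀ᶠ q in 𝓝 p,
      canU g Z q = s • pull2 (patchFrame m a Φ q) planeForm ∧
      hodge2 (g q) (canU g Z q)
        = (s * orient (patchFrame m a Φ p)) • pull2 (patchFrame m a Φ q) planeDual := by
  have hf := hg.movingFrame
  set x : Pt → ℝ := fun q => 3 * (kerrRe m a (Φ q)
      * pair2 (g q) (pull2 (patchFrame m a Φ q) planeForm) (Z q)
    + kerrIm m a (Φ q) * pair2 (g q) (pull2 (patchFrame m a Φ q) planeDual) (Z q)) with hx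
  -- The orientation occurs squared, so it does not affect the continuity of `x`.
  have hxq : ∀ q ∈ Ω, x q = 3 * (kerrRe m a (Φ q)
      * pair2 (g q) (pull2 (patchFrame m a Φ q) planeForm) (Z q)
      + orient (patchFrame m a Φ q) * kerrIm m a (Φ q) * pair2 (g q)
        (orient (patchFrame m a Φ q) • pull2 (patchFrame m a Φ q) planeDual) (Z q)) := by
    intro q hq
    have ho := orient_mul_self (hf.det_ne q hq)
    rw [pair2_smul_left, hx]
    linear_combination -3 * kerrIm m a (Φ q)
      * pair2 (g q) (pull2 (patchFrame m a Φ q) planeDual) (Z q) * ho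
  have hab : ∀ q ∈ Ω, kerrRe m a (Φ q) ^ 2
      + (orient (patchFrame m a Φ q) * kerrIm m a (Φ q)) ^ 2 ≠ 0 := by
    intro q hq
    rw [hg.weyl_ne hq]
    have := kerrSigma_pos (hg.mapsTo hq)
    positivity
  have hxp : x p ≠ 0 := by
    rw [Admissible, hg.weyl_eq hp] at hU
    exact ((hg.isDualPair hp).bivU_typeD (hab p hp) (hxq p hp)).1.1 hU
  have hcont : ContinuousAt x p := by
    have hgm : MDiffAt g p := ((((hf.mdiff hp).transpose.mul (MDiffAt.const frameMetric p)).mul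
      (hf.mdiff hp))).congr ((hf.eventually_mem hp).mono fun q hq => hf.metric q hq)
    have hpull : ∀ X : Tensor2, MDiffAt (fun q => pull2 (patchFrame m a Φ q) X) p := fun X =>
      ((hf.mdiff hp).transpose.mul (MDiffAt.const X p)).mul (hf.mdiff hp)
    have hdet := (hg.isDualPair hp).det_ne
    have h1 := differentiableAt_pair2 hgm hdet (hpull planeForm) hZ
    have h2 := differentiableAt_pair2 hgm hdet (hpull planeDual) hZ
    have hΦ : DifferentiableAt ℝ Φ p := (hg.contDiffAt hp).differentiableAt (by norm_num)
    have hu : DifferentiableAt ℝ (fun q => kerrU a (Φ q)) p :=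
      (differentiableAt_kerrU (hg.mapsTo hp).1).comp p hΦ
    have hv : DifferentiableAt ℝ (fun q => kerrV a (Φ q)) p :=
      (differentiableAt_kerrV (hg.mapsTo hp).1).comp p hΦ
    refine DifferentiableAt.continuousAt (𝕜 := ℝ) ?_
    rw [hx]
    simp only [kerrRe, kerrIm]
    fun_prop
  have hsign := eventually_sign_eq hcont hxp
  refine ⟨SignType.sign (x p), ?_, ?_⟩
  · rcases lt_or_gt_of_ne hxp with h | h
    · right; simp [sign_neg h]
    · left; simp [sign_pos h]
  · filter_upwards [hsign, hf.eventually_mem hp, hcont.eventually_ne hxp,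
      hg.eventually_orient hp] with q h1 hq h2 h3
    have hc : canU g Z q = (SignType.sign (x p) : ℝ) • pull2 (patchFrame m a Φ q) planeForm := by
      rw [canU, hg.weyl_eq hq, ← h1]
      exact ((hg.isDualPair hq).bivU_typeD (hab q hq) (hxq q hq)).2 h2
    refine ⟨hc, ?_⟩
    have h4 := (hg.isDualPair hq).hodge_left
    rw [hc, hodge2, act4_smul_right, ← hodge2, h4, h3, smul_smul]

/-- Constant multiples of `timeForm` satisfy the Killing equation. -/
theorem IsKerrOn.killing {u : Pt → Pt} {t : ℝ} (hu : ∀ᶠ q in 𝓝 p, u q = t • timeForm m a Φ q)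
    (i j : Fin 4) : covDeriv1 g u i j p + covDeriv1 g u j i p = 0 := by
  have hx := hg.mapsTo hp
  have hΦ : DifferentiableAt ℝ Φ p := (hg.contDiffAt hp).differentiableAt (by norm_num)
  have hk : ∀ α, DifferentiableAt ℝ (fun y => kerrTime m a y α) (Φ p) := by
    have hD := differentiableAt_kerrDelta m a (Φ p)
    have hU := differentiableAt_kerrU hx.1
    have hV := differentiableAt_kerrV hx.1
    intro α
    fin_cases α <;> simp [kerrTime] <;> fun_prop
  have hz : ∀ α, DifferentiableAt ℝ (fun q => (t • kerrTime m a (Φ q)) α) p := fun α =>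
    ((hk α).comp p hΦ).const_mul t
  have hu' : ∀ᶠ q in 𝓝 p, ∀ j, u q j
      = ∑ α, patchFrame m a Φ q α j * (t • kerrTime m a (Φ q)) α := by
    filter_upwards [hu] with q hq j
    rw [hq]
    simp only [timeForm, Matrix.mulVec, dotProduct, Pi.smul_apply, smul_eq_mul,
      Matrix.transpose_apply, Finset.mul_sum]
    exact Finset.sum_congr rfl fun α _ => by ring
  set A : Fin 4 → Fin 4 → ℝ := fun k α => pderiv k (fun y => kerrTime m a y α) (Φ p)
    - ∑ β, kerrConn m a k (Φ p) β α * kerrTime m a (Φ p) β with hA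
  -- `∇_i u_j` is the pullback of a tensor on the Kerr side, whose symmetric part vanishes.
  have key : ∀ i j, covDeriv1 g u i j p = t * ∑ k, ∑ l, jacobian Φ p k i * jacobian Φ p l j
      * ∑ α, A k α * kerrFrame m a (Φ p) α l := by
    intro i j
    rw [hg.movingFrame.covDeriv1_eq hp hz hu']
    have h1 : ∀ α, pderiv i (fun q => (t • kerrTime m a (Φ q)) α) p
        - ∑ β, pullConn (kerrConn m a) Φ i p β α * (t • kerrTime m a (Φ p)) β
        = t * ∑ k, jacobian Φ p k i * A k α := by
      intro α
      have h2 : pderiv i (fun q => (t • kerrTime m a (Φ q)) α) p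
          = t * ∑ k, pderiv k (fun y => kerrTime m a y α) (Φ p) * jacobian Φ p k i := by
        rw [← pderiv_comp (hk α) hΦ]
        have := pderiv_mul (i := i) (differentiableAt_const t) ((hk α).comp p hΦ)
        rw [pderiv_const, zero_mul, zero_add] at this
        exact this
      have h3 : ∑ β, pullConn (kerrConn m a) Φ i p β α * (t • kerrTime m a (Φ p)) β
          = t * ∑ k, jacobian Φ p k i * ∑ β, kerrConn m a k (Φ p) β α * kerrTime m a (Φ p) β := by
        simp only [pullConn_apply, Pi.smul_apply, smul_eq_mul, Finset.mul_sum, Finset.sum_mul]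
        rw [Finset.sum_comm]
        exact Finset.sum_congr rfl fun k _ => Finset.sum_congr rfl fun β _ => by ring
      rw [h2, h3, ← mul_sub, ← Finset.sum_sub_distrib]
      congr 1
      exact Finset.sum_congr rfl fun k _ => by rw [hA]; ring
    simp only [h1]
    have h4 : ∀ α, patchFrame m a Φ p α j = ∑ l, kerrFrame m a (Φ p) α l * jacobian Φ p l j :=
      fun α => Matrix.mul_apply
    simp only [h4, mul_left_comm _ t, ← Finset.mul_sum]
    congr 1
    have h5 : ∀ α, (∑ l, kerrFrame m a (Φ p) α l * jacobian Φ p l j)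
        * ∑ k, jacobian Φ p k i * A k α
        = ∑ k, ∑ l, jacobian Φ p k i * jacobian Φ p l j * (A k α * kerrFrame m a (Φ p) α l) := by
      intro α
      rw [mul_comm, Finset.sum_mul_sum]
      exact Finset.sum_congr rfl fun k _ => Finset.sum_congr rfl fun l _ => by ring
    rw [Finset.sum_congr rfl fun α _ => h5 α, Finset.sum_comm]
    refine Finset.sum_congr rfl fun k _ => ?_
    rw [Finset.sum_comm]
    exact Finset.sum_congr rfl fun l _ => (Finset.mul_sum _ _ _).symm
  rw [key, key, ← mul_add, Finset.sum_comm (f := fun k l => jacobian Φ p k j * jacobian Φ p l i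
    * ∑ α, A k α * kerrFrame m a (Φ p) α l)]
  simp only [← Finset.sum_add_distrib]
  refine mul_eq_zero_of_right _ (Finset.sum_eq_zero fun k _ => Finset.sum_eq_zero fun l _ => ?_)
  rw [mul_comm (jacobian Φ p l j), ← mul_add, hA, kerr_killing hx.1 hx.2.1 k l, mul_zero]
end

/-! ### Scalar identities and the theorem -/
theorem cbrt_cube (t : ℝ) : cbrt (t ^ 3) = t := by
  have h : ∀ t : ℝ, 0 ≤ t → (t ^ 3) ^ (1 / 3 : ℝ) = t := fun t ht => by
    rw [← Real.rpow_natCast, ← Real.rpow_mul ht]; norm_num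
  rw [cbrt, abs_pow, h _ (abs_nonneg t)]
  rcases lt_trichotomy t 0 with ht | rfl | ht
  · rw [Real.sign_of_neg (by exact Odd.pow_neg (by decide) ht), abs_of_neg ht]; ring
  · simp
  · rw [Real.sign_of_pos (by positivity), abs_of_pos ht, one_mul]

/-- The identities `3λ² - 1 = (3y² - r²)/r²`, `1 + λ² = S/r²` and `σ = (r/S)²`, where `y = a cos θ`,
`S = Σ` and `λ = ±y/r`. -/
theorem sigma_scalar {m r y S : ℝ} (hS : S = r ^ 2 + y ^ 2) (hS0 : 0 < S) (hr : r ≠ 0)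
    (h3 : 3 * y ^ 2 ≠ r ^ 2) {o : ℝ} (ho : o * o = 1) {lam al dsq : ℝ} (hl : lam = o * y / r)
    (hal : al = m * (3 * r * y ^ 2 - r ^ 3) / S ^ 3)
    (hd : dsq = 4 * (r / S) ^ 2 * ((2 * m * r - S) / S)) :
    3 * lam ^ 2 - 1 = (3 * y ^ 2 - r ^ 2) / r ^ 2 ∧
    1 + lam ^ 2 = S / r ^ 2 ∧
    2 * al / (3 * lam ^ 2 - 1) - (1 / 4) * dsq = (r / S) ^ 2 := by
  have h1 : lam ^ 2 = y ^ 2 / r ^ 2 := by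
    rw [hl, div_pow, mul_pow, sq o, ho, one_mul]
  have h2 : 3 * lam ^ 2 - 1 = (3 * y ^ 2 - r ^ 2) / r ^ 2 := by
    rw [h1]; field_simp
  have h4 : 3 * y ^ 2 - r ^ 2 ≠ 0 := sub_ne_zero.2 h3
  refine ⟨h2, ?_, ?_⟩
  · rw [h1, hS]; field_simp
  · rw [h2, hal, hd]; field_simp; ring

/-- The mass formula after substitution of `α` and `σ`, with `y = a cos θ` and `S = Σ`. -/
theorem mass_scalar {m r y S : ℝ} (hm : 0 < m) (hS0 : 0 < S) (hr : r ≠ 0)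
    (h3 : 3 * y ^ 2 ≠ r ^ 2) :
    m = |m * (3 * r * y ^ 2 - r ^ 3) / S ^ 3| /
      ((r / S) ^ 2 * Real.sqrt ((r / S) ^ 2) * |(3 * y ^ 2 - r ^ 2) / r ^ 2|) := by
  have h4 : |3 * y ^ 2 - r ^ 2| ≠ 0 := abs_ne_zero.2 (sub_ne_zero.2 h3)
  have h5 : |r| ≠ 0 := abs_ne_zero.2 hr
  have h6 : (r / S) ^ 2 = |r| ^ 2 / S ^ 2 := by rw [div_pow, sq_abs]
  rw [Real.sqrt_sq_eq_abs, show m * (3 * r * y ^ 2 - r ^ 3) = m * r * (3 * y ^ 2 - r ^ 2) by ring,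
    h6]
  simp only [abs_div, abs_mul, abs_pow, abs_of_pos hm, abs_of_pos hS0]
  generalize |3 * y ^ 2 - r ^ 2| = k at h4 ⊢
  field_simp

/-- The angular momentum formula after substitution of `λ² = l2`, `σ` and `h(δU, δU)`, with
`y = a cos θ`, `s = sin θ` and `S = Σ`. -/
theorem spin_scalar {a r y S s : ℝ} (ha : 0 < a) (hS0 : 0 < S) (hr : r ≠ 0)
    (hs : a ^ 2 * s ^ 2 + y ^ 2 = a ^ 2) {l2 : ℝ} (hl : l2 = y ^ 2 / r ^ 2)
    (hl' : 1 + l2 = S / r ^ 2) :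
    a = 1 / (2 * (r / S) ^ 2 * Real.sqrt (1 + l2)) *
      Real.sqrt (4 * (r / S) ^ 2 * (a ^ 2 * s ^ 2 / S) + 4 * (r / S) ^ 2 * l2 / (1 + l2)) := by
  have h5 : 0 < |r| := abs_pos.2 hr
  have h1 : 4 * (r / S) ^ 2 * (a ^ 2 * s ^ 2 / S) + 4 * (r / S) ^ 2 * l2 / (1 + l2)
      = (2 * a * |r|) ^ 2 / S ^ 2 / S := by
    rw [hl', hl, mul_pow, sq_abs]
    field_simp
    linear_combination 4 * hs
  have hsp := Real.sqrt_pos.2 hS0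
  rw [h1, hl', Real.sqrt_div hS0.le, Real.sqrt_div (by positivity), Real.sqrt_div (by positivity),
    Real.sqrt_sq_eq_abs r, Real.sqrt_sq (by positivity), Real.sqrt_sq hS0.le, div_pow, ← sq_abs r]
  field_simp
  exact Real.sq_sqrt hS0.le

/-- The coefficient of `timeForm` in `xiForm`: the radicand is the cube of `-S / (m^{1/3} r)`. -/
theorem cbrt_scalar {m r y S : ℝ} (hm : 0 < m) (hS0 : 0 < S) (hr : r ≠ 0)
    (h3 : 3 * y ^ 2 ≠ r ^ 2) {l2 : ℝ} (hl : l2 = y ^ 2 / r ^ 2) (s : ℝ) :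
    cbrt ((1 - 3 * l2) / (m * (3 * r * y ^ 2 - r ^ 3) / S ^ 3)) / Real.sqrt 2
      * (-2 * s * (r / S)) = s * (Real.sqrt 2 / m ^ (1 / 3 : ℝ)) := by
  have hμ : (m ^ (1 / 3 : ℝ)) ^ 3 = m := by
    rw [← Real.rpow_natCast, ← Real.rpow_mul hm.le]; norm_num
  have hμ0 : 0 < m ^ (1 / 3 : ℝ) := Real.rpow_pos_of_pos hm _
  generalize m ^ (1 / 3 : ℝ) = μ at hμ hμ0 ⊢
  have h4 : 3 * y ^ 2 - r ^ 2 ≠ 0 := sub_ne_zero.2 h3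
  have h5 : (1 - 3 * l2) / (m * (3 * r * y ^ 2 - r ^ 3) / S ^ 3) = (-(S / (μ * r))) ^ 3 := by
    rw [show m * (3 * r * y ^ 2 - r ^ 3) = m * r * (3 * y ^ 2 - r ^ 2) by ring, hl, ← hμ]
    field_simp
    ring
  have h6 : Real.sqrt 2 ^ 2 = 2 := Real.sq_sqrt (by norm_num)
  have h7 : Real.sqrt 2 ≠ 0 := by positivity
  rw [h5, cbrt_cube]
  field_simp
  rw [h6]

end KerrWeyl

end

open KerrWeyl Filter in
theorem proposition3 (m a : ℝ) (hm : 0 < m) (ha : 0 < a)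
    (g : KerrWeyl.Pt → KerrWeyl.Tensor2) (Ω : Set KerrWeyl.Pt)
    (Φ : KerrWeyl.Pt → KerrWeyl.Pt) (hg : KerrWeyl.IsKerrOn m a g Ω Φ)
    (Z : KerrWeyl.Pt → KerrWeyl.Tensor2)
    (hZsmooth : ∀ i j, ContDiffOn ℝ ∞ (fun q => Z q i j) Ω)
    (hZskew : ∀ q ∈ Ω, ∀ i j, Z q i j = -Z q j i)
    (p : KerrWeyl.Pt) (hp : p ∈ Ω)
    (hU : KerrWeyl.Admissible g Z p)
    (hδU : KerrWeyl.deltaUSq g Z p ≠ 0)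
    (hlam : 3 * KerrWeyl.lam g Z p ^ 2 ≠ 1) :
    -- `σ > 0` and the mass
    0 < KerrWeyl.sigma g Z p ∧
    m = |KerrWeyl.alpha g p| /
        (KerrWeyl.sigma g Z p * Real.sqrt (KerrWeyl.sigma g Z p)
          * |3 * KerrWeyl.lam g Z p ^ 2 - 1|) ∧
    -- the angular momentum
    a = 1 / (2 * KerrWeyl.sigma g Z p * Real.sqrt (1 + KerrWeyl.lam g Z p ^ 2))
        * Real.sqrt (KerrWeyl.hDelta g Z p
          + 4 * KerrWeyl.sigma g Z p * KerrWeyl.lam g Z p ^ 2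
            / (1 + KerrWeyl.lam g Z p ^ 2)) ∧
    -- `ξ` is `w^{-1/3} δ𝒰`, where `w = α + iβ` and `𝒰 = (U - i *U)/√2`
    (∃ κ : ℂ, κ ^ 3 = (KerrWeyl.alpha g p : ℂ) + Complex.I * (KerrWeyl.beta g p : ℂ) ∧
      ∀ i, (KerrWeyl.xiForm g Z p i : ℂ) = κ⁻¹ *
        (((KerrWeyl.deltaU g Z p i : ℂ) - Complex.I * (KerrWeyl.deltaStarU g Z p i : ℂ))
          / (Real.sqrt 2 : ℂ))) ∧
    -- `ξ` is a Killing vector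
    (∀ i j, KerrWeyl.covDeriv1 g (KerrWeyl.xiForm g Z) i j p
      + KerrWeyl.covDeriv1 g (KerrWeyl.xiForm g Z) j i p = 0) ∧
    -- `ξ` is the stationary Killing vector `∂_t`, up to a constant factor
    (∃ s : ℝ, (s = 1 ∨ s = -1) ∧ ∀ᶠ q in 𝓝 p,
      (KerrWeyl.jacobian Φ q).mulVec (KerrWeyl.xiVec g Z q)
        = (s * (Real.sqrt 2 / m ^ (1 / 3 : ℝ))) • KerrWeyl.basisVec 0) := by
  have hΩ : ∀ᶠ q in 𝓝 p, q ∈ Ω := hg.isOpen.mem_nhds hp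
  have hZ : MDiffAt Z p := fun i j =>
    ((hZsmooth i j).contDiffAt (hg.isOpen.mem_nhds hp)).differentiableAt (by simp)
  obtain ⟨s, hs, hcan⟩ := hg.canU_eventually hp hm.ne' hZ hU
  have hss : s * s = 1 := by rcases hs with rfl | rfl <;> norm_num
  set o := orient (patchFrame m a Φ p) with ho_def
  have ho : o * o = 1 := orient_mul_self (hg.movingFrame.det_ne p hp)
  have hδ : ∀ᶠ q in 𝓝 p,
      deltaU g Z q = (-2 * s * kerrU a (Φ q)) • timeForm m a Φ q ∧
      deltaStarU g Z q = (-2 * (s * o) * kerrV a (Φ q)) • timeForm m a Φ q := by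
    filter_upwards [hcan.eventually_nhds, hΩ] with q hq hqΩ
    exact ⟨hg.codiff_plane hqΩ (hq.mono fun _ h => h.1),
      hg.codiff_planeDual hqΩ (hq.mono fun _ h => h.2)⟩
  -- Explicit values of `(δU)²`, `λ`, `α`, `β` and `ξ` at the points where `δU` and `δ*U` are known.
  have hsq : ∀ q ∈ Ω, deltaU g Z q = (-2 * s * kerrU a (Φ q)) • timeForm m a Φ q →
      deltaUSq g Z q = 4 * (Φ q 1 / kerrSigma a (Φ q)) ^ 2
        * ((2 * m * Φ q 1 - kerrSigma a (Φ q)) / kerrSigma a (Φ q)) := by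
    intro q hq h
    rw [deltaUSq, h, inner1_smul, hg.inner1_timeForm hq, kerrU]
    linear_combination 4 * (Φ q 1 / kerrSigma a (Φ q)) ^ 2
        * ((2 * m * Φ q 1 - kerrSigma a (Φ q)) / kerrSigma a (Φ q)) * hss
  have hlam' : ∀ q ∈ Ω, deltaU g Z q = (-2 * s * kerrU a (Φ q)) • timeForm m a Φ q →
      deltaStarU g Z q = (-2 * (s * o) * kerrV a (Φ q)) • timeForm m a Φ q →
      deltaUSq g Z q ≠ 0 → Φ q 1 ≠ 0 ∧
        lam g Z q = o * (a * Real.cos (Φ q 2)) / Φ q 1 := by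
    intro q hq h1 h2 h3
    rw [hsq q hq h1] at h3
    have hr : Φ q 1 ≠ 0 := by
      intro h0; rw [h0] at h3; simp at h3
    have hn : (2 * m * Φ q 1 - kerrSigma a (Φ q)) / kerrSigma a (Φ q) ≠ 0 :=
      right_ne_zero_of_mul h3
    refine ⟨hr, ?_⟩
    rw [lam, hsq q hq h1, h1, h2, inner1_smul, hg.inner1_timeForm hq, kerrU, kerrV,
      div_eq_div_iff h3 hr]
    linear_combination 4 * (Φ q 1 / kerrSigma a (Φ q)) * o * (a * Real.cos (Φ q 2)
      / kerrSigma a (Φ q)) * ((2 * m * Φ q 1 - kerrSigma a (Φ q)) / kerrSigma a (Φ q))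
      * Φ q 1 * hss
  have hal : ∀ q ∈ Ω, alpha g q = kerrRe m a (Φ q) ∧
      beta g q = orient (patchFrame m a Φ q) * kerrIm m a (Φ q) := by
    intro q hq
    have hS := kerrSigma_pos (hg.mapsTo hq)
    have h0 := hg.weyl_ne hq
    have := (hg.isDualPair hq).eig_typeD (a := kerrRe m a (Φ q))
      (b := orient (patchFrame m a Φ q) * kerrIm m a (Φ q)) (by rw [h0]; positivity)
    rw [alpha, beta, hg.weyl_eq hq]
    exact this
  have hRe : ∀ q ∈ Ω, kerrRe m a (Φ q) = m * (3 * Φ q 1 * (a * Real.cos (Φ q 2)) ^ 2 - Φ q 1 ^ 3)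
      / kerrSigma a (Φ q) ^ 3 := by
    intro q hq
    have hS := (kerrSigma_pos (hg.mapsTo hq)).ne'
    rw [kerrRe, kerrU, kerrV]
    field_simp
  have hxi : ∀ q ∈ Ω, deltaU g Z q = (-2 * s * kerrU a (Φ q)) • timeForm m a Φ q →
      deltaStarU g Z q = (-2 * (s * o) * kerrV a (Φ q)) • timeForm m a Φ q →
      deltaUSq g Z q ≠ 0 → 3 * lam g Z q ^ 2 ≠ 1 →
      xiForm g Z q = (s * (Real.sqrt 2 / m ^ (1 / 3 : ℝ))) • timeForm m a Φ q := by
    intro q hq h1 h2 h3 h4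
    obtain ⟨hr, hl⟩ := hlam' q hq h1 h2 h3
    have hl2 : lam g Z q ^ 2 = (a * Real.cos (Φ q 2)) ^ 2 / Φ q 1 ^ 2 := by
      rw [hl, div_pow, mul_pow, sq o, ho, one_mul]
    have h5 : 3 * (a * Real.cos (Φ q 2)) ^ 2 ≠ Φ q 1 ^ 2 := by
      intro h; apply h4; rw [hl2, mul_div_assoc', h, div_self (pow_ne_zero 2 hr)]
    have hc := cbrt_scalar hm (kerrSigma_pos (hg.mapsTo hq)) hr h5 hl2 s
    rw [xiForm, h1, smul_smul, (hal q hq).1, hRe q hq, ← hc, kerrU]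
  -- The two nondegeneracy conditions are open, since `(δU)²` and `λ` have continuous expressions
  -- in `Φ`.
  have hev : ∀ᶠ q in 𝓝 p, xiForm g Z q
      = (s * (Real.sqrt 2 / m ^ (1 / 3 : ℝ))) • timeForm m a Φ q := by
    have hΦ : ContinuousAt Φ p := (hg.contDiffAt hp).continuousAt
    have hc1 : ContinuousAt (fun q => Φ q 1) p := (continuousAt_pi.1 hΦ) 1
    have hc2 : ContinuousAt (fun q => Φ q 2) p := (continuousAt_pi.1 hΦ) 2
    have hcS : ContinuousAt (fun q => kerrSigma a (Φ q)) p := by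
      unfold kerrSigma; fun_prop
    have hS0 : kerrSigma a (Φ p) ≠ 0 := (hg.mapsTo hp).1
    obtain ⟨hδ1, hδ2⟩ := hδ.self_of_nhds
    have hr := (hlam' p hp hδ1 hδ2 hδU).1
    have e1 : ∀ᶠ q in 𝓝 p, deltaUSq g Z q ≠ 0 := by
      have hc : ContinuousAt (fun q => 4 * (Φ q 1 / kerrSigma a (Φ q)) ^ 2
        * ((2 * m * Φ q 1 - kerrSigma a (Φ q)) / kerrSigma a (Φ q))) p := by
        fun_prop (disch := exact hS0)
      rw [hsq p hp hδ1] at hδU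
      filter_upwards [hc.eventually_ne hδU, hδ, hΩ] with q h1 h2 h3
      rwa [hsq q h3 h2.1]
    have e2 : ∀ᶠ q in 𝓝 p, 3 * lam g Z q ^ 2 ≠ 1 := by
      have hc : ContinuousAt (fun q => 3 * (o * (a * Real.cos (Φ q 2)) / Φ q 1) ^ 2) p := by
        fun_prop (disch := exact hr)
      rw [(hlam' p hp hδ1 hδ2 hδU).2] at hlam
      filter_upwards [hc.eventually_ne hlam, hδ, hΩ, e1] with q h1 h2 h3 h4
      rwa [(hlam' q h3 h2.1 h2.2 h4).2]
    filter_upwards [e1, e2, hδ, hΩ] with q h1 h2 h3 h4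
    exact hxi q h4 h3.1 h3.2 h1 h2
  obtain ⟨hδ1, hδ2⟩ := hδ.self_of_nhds
  obtain ⟨hr, hl⟩ := hlam' p hp hδ1 hδ2 hδU
  obtain ⟨ha1, hb1⟩ := hal p hp
  have hS := kerrSigma_pos (hg.mapsTo hp)
  have hS' : kerrSigma a (Φ p) = Φ p 1 ^ 2 + (a * Real.cos (Φ p 2)) ^ 2 := by
    rw [kerrSigma, mul_pow]
  have hl2 : lam g Z p ^ 2 = (a * Real.cos (Φ p 2)) ^ 2 / Φ p 1 ^ 2 := by
    rw [hl, div_pow, mul_pow, sq o, ho, one_mul]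
  have h3 : 3 * (a * Real.cos (Φ p 2)) ^ 2 ≠ Φ p 1 ^ 2 := by
    intro h; apply hlam; rw [hl2, mul_div_assoc', h, div_self (pow_ne_zero 2 hr)]
  obtain ⟨e1, e2, e3⟩ := sigma_scalar hS' hS hr h3 ho hl (ha1.trans (hRe p hp)) (hsq p hp hδ1)
  have hσ : sigma g Z p = (Φ p 1 / kerrSigma a (Φ p)) ^ 2 := e3
  have hu : kerrU a (Φ p) ≠ 0 := div_ne_zero hr hS.ne'
  refine ⟨?_, ?_, ?_, ?_, hg.killing hp hev, s, hs, ?_⟩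
  · rw [hσ]; exact sq_pos_of_ne_zero hu
  · rw [hσ, e1, ha1, hRe p hp]
    exact mass_scalar hm hS hr h3
  · have hh : hDelta g Z p = 4 * (Φ p 1 / kerrSigma a (Φ p)) ^ 2
        * (a ^ 2 * Real.sin (Φ p 2) ^ 2 / kerrSigma a (Φ p)) := by
      rw [← hg.projH_timeForm hp hss, hDelta, hcan.self_of_nhds.1, hδ1, sharp_smul, Finset.mul_sum]
      refine Finset.sum_congr rfl fun i _ => ?_
      rw [Finset.mul_sum]
      refine Finset.sum_congr rfl fun j _ => ?_
      rw [Pi.smul_apply, Pi.smul_apply, smul_eq_mul, smul_eq_mul, kerrU]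
      linear_combination 4 * (Φ p 1 / kerrSigma a (Φ p)) ^ 2
        * projH (g p) (s • pull2 (patchFrame m a Φ p) planeForm) i j
        * sharp (g p) (timeForm m a Φ p) i * sharp (g p) (timeForm m a Φ p) j * hss
    rw [hσ, hh]
    refine spin_scalar ha hS hr ?_ hl2 e2
    linear_combination a ^ 2 * Real.sin_sq_add_cos_sq (Φ p 2)
  · have hμ : (m ^ (1 / 3 : ℝ)) ^ 3 = m := by
      rw [← Real.rpow_natCast, ← Real.rpow_mul hm.le]; norm_num
    have hμ0 : m ^ (1 / 3 : ℝ) ≠ 0 := (Real.rpow_pos_of_pos hm _).ne'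
    have hx := hev.self_of_nhds
    generalize m ^ (1 / 3 : ℝ) = μ at hμ hμ0 hx
    have hz : (kerrU a (Φ p) : ℂ) - Complex.I * (o * kerrV a (Φ p)) ≠ 0 := by
      intro h
      apply hu
      simpa using congrArg Complex.re h
    have hoc : (o : ℂ) * o = 1 := by exact_mod_cast ho
    have hμc : (μ : ℂ) ^ 3 = m := by exact_mod_cast hμ
    have hμ0c : (μ : ℂ) ≠ 0 := by exact_mod_cast hμ0
    -- With `τ` the form `timeForm`, `w = -m (u - i o v)³` and `δU - i δ*U = -2 s (u - i o v) τ`, so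
    -- the cube root is `-m^{1/3} (u - i o v)`.
    refine ⟨-μ * (kerrU a (Φ p) - Complex.I * (o * kerrV a (Φ p))), ?_, fun i => ?_⟩
    · rw [ha1, hb1, kerrRe, kerrIm, ← ho_def]
      push_cast
      rw [← hμc]
      linear_combination (-(3 * (μ : ℂ) ^ 3 * kerrU a (Φ p) * kerrV a (Φ p) ^ 2 * o ^ 2)
          + Complex.I * (μ : ℂ) ^ 3 * kerrV a (Φ p) ^ 3 * o ^ 3) * Complex.I_sq
        + (3 * (μ : ℂ) ^ 3 * kerrU a (Φ p) * kerrV a (Φ p) ^ 2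
          - Complex.I * (μ : ℂ) ^ 3 * kerrV a (Φ p) ^ 3 * o) * hoc
    · have h2c : ((Real.sqrt 2 : ℝ) : ℂ) ^ 2 = 2 := by
        exact_mod_cast Real.sq_sqrt (by norm_num : (0 : ℝ) ≤ 2)
      have h20 : ((Real.sqrt 2 : ℝ) : ℂ) ≠ 0 := by
        intro h; rw [h] at h2c; norm_num at h2c
      rw [hx, hδ1, hδ2]
      simp only [Pi.smul_apply, smul_eq_mul]
      push_cast
      have hn : -2 * (s : ℂ) * kerrU a (Φ p) * timeForm m a Φ p i
          - Complex.I * (-2 * (s * o) * kerrV a (Φ p) * timeForm m a Φ p i)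
          = -2 * s * timeForm m a Φ p i
            * (kerrU a (Φ p) - Complex.I * (o * kerrV a (Φ p))) := by ring
      rw [hn]
      generalize (kerrU a (Φ p) : ℂ) - Complex.I * (o * kerrV a (Φ p)) = z at hz ⊢
      field_simp
      rw [h2c]
      ring
  · filter_upwards [hev, hΩ] with q h1 h2
    rw [xiVec, h1, sharp_smul, Matrix.mulVec_smul, hg.jacobian_sharp_timeForm h2]
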